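/- Let $K$ be an arbitrary field and $\ell$ a prime. For a (Krull) valuation $v$ of $K$ let $\mathcal O_v$, $\mathfrak m_v$ denote its valuation ring and valuation ideal; the trivial valuation is allowed. A subgroup $H\le K^\times$ is called valuative if $\mathcal O_v^\times\le H$ for some valuation $v$ of $K$; in that case $v_H$ denotes the unique coarsest valuation $v$ of $K$ with $\mathcal O_{v}^\times\le H$. Let $\widehat K=\varprojlim_n K^\times/(K^\times)^{\ell^n}$, a $\mathbb Z_\ell$-module; submodules $\widehat T\le\widehat K$ are always taken to be closed for the inverse limit topology, $K^\times\cap\widehat T$ denotes the inverse image of $\widehat T$ under $K^\times\to\widehat K$, and for $S\subseteq K^\times$ one writes $S\subseteq\widehat T$ for $S\subseteq K^\times\cap\widehat T$. A submodule $\widehat H\le \widehat K$ is called valuative if $K^\times\cap\widehat H$ is, and then $v_{\widehat H}:=v_{K^\times\cap\widehat H}$. A subgroup $T\le K^\times$ is called rigid if for all $x\in K^\times\smallsetminus T$ the image of $\langle x,1-x\rangle$ in $K^\times/T$ is cyclic; a submodule $\widehat T\le\widehat K$ is called rigid if for all $x\in K^\times$ with $x\notin\widehat T$ the image of $\langle x,1-x\rangle$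 in $\widehat K/\widehat T$ is a cyclic $\mathbb Z_\ell$-module. (1) Let $T\le K^\times$ be a subgroup with $(K^\times)^{\ell}\le T$ and $-1\in T$. Let $\mathbf H(T)$ be the intersection of all subgroups $H$ with $T\le H\le K^\times$ such that $K^\times/H$ is cyclic (possibly trivial) and such that $H\cap H'$ is rigid for every $H'$ with $T\le H'\le K^\times$ and $K^\times/H'$ cyclic. Assume $T\ne\mathbf H(T)$. Then $H=\mathbf H(T)$ is valuative and, for $v=v_H$, one has $1+\mathfrak m_v\le T$ and $T\cdot\mathcal O_v^\times=H$. (2) Let $\widehat T\le\widehat K$ be a submodule such that $\widehat K/\widehat T$ is torsion-free. Let $\mathbf H(\widehat T)$ be the intersection of all submodules $\widehat H$ with $\widehat T\le\widehat H\le\widehat K$ such that $\widehat K/\widehat H$ is torsion-free and cyclic (possibly trivial) and such that $\widehat H\cap\widehat H'$ is rigid for every $\widehat H'$ with $\widehat T\le\widehat H'\le\widehat K$ and $\widehat K/\widehat H'$ torsion-free cyclic. Assume $\widehat T\neq\mathbf H(\widehat T)$. Then $\widehat H=\mathbf H(\widehat T)$ is valuative and, for $v=v_{\widehat H}$, one has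 $1+\mathfrak m_v\le\widehat T$, and $\widehat H$ is the smallest submodule of $\widehat K$ such that $\widehat K/\widehat H$ is torsion-free, $\widehat T\le\widehat H$ and $\mathcal O_v^\times\le\widehat H$. -/

import Mathlib

namespace ValRec

section ModL

variable {K : Type*} [Field K]

/-- A subgroup `H ≤ Kˣ` is valuative if it contains the unit group of some valuation of `K`. -/
def IsValuative (H : Subgroup Kˣ) : Prop :=
  ∃ v : ValuationSubring K, v.unitGroup ≤ H

/-- `v` is the coarsest valuation of `K` whose units lie in `H`. (A valuation is coarser than
another one when its valuation ring is larger; such a `v` is unique.) -/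
def IsCanonicalValuation (H : Subgroup Kˣ) (v : ValuationSubring K) : Prop :=
  IsGreatest {w : ValuationSubring K | w.unitGroup ≤ H} v

/-- A subgroup `T ≤ Kˣ` is rigid if for all `x ∈ Kˣ ∖ T` the image of `⟨x, 1 - x⟩` in `Kˣ/T` is
cyclic. The unit `y` below is `1 - x`, which is nonzero because `1 ∈ T`. -/
def IsRigid (T : Subgroup Kˣ) : Prop :=
  ∀ x y : Kˣ, x ∉ T → (y : K) = 1 - (x : K) →
    IsCyclic ((Subgroup.closure {x, y}).map (QuotientGroup.mk' T))

/-- The subgroup `𝐇(T)`. -/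
def bigH (T : Subgroup Kˣ) : Subgroup Kˣ :=
  sInf {H : Subgroup Kˣ | T ≤ H ∧ IsCyclic (Kˣ ⧸ H) ∧
    ∀ H' : Subgroup Kˣ, T ≤ H' → IsCyclic (Kˣ ⧸ H') → IsRigid (H ⊓ H')}

end ModL

section Completion

/-- The `ℓ`-adic completion `K̂ = lim Kˣ/(Kˣ)^(ℓ^n)` of the unit group of `K`, in additive
notation. -/
def KHat (ℓ : ℕ) (K : Type*) [Field K] : Type _ :=
  AdicCompletion (Ideal.span {(ℓ : ℤ)}) (Additive Kˣ)

variable {ℓ : ℕ} {K : Type*} [Field K]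

noncomputable instance : AddCommGroup (KHat ℓ K) :=
  inferInstanceAs (AddCommGroup (AdicCompletion (Ideal.span {(ℓ : ℤ)}) (Additive Kˣ)))

variable (ℓ K) in
/-- `Kˣ/(Kˣ)^(ℓ^n)`, in additive notation. -/
abbrev KMod (n : ℕ) : Type _ :=
  Additive Kˣ ⧸ ((Ideal.span {(ℓ : ℤ)}) ^ n • ⊤ : Submodule ℤ (Additive Kˣ))

/-- The projection `K̂ → Kˣ/(Kˣ)^(ℓ^n)`. -/
noncomputable def KHat.proj (n : ℕ) : KHat ℓ K →+ KMod ℓ K n :=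
  (AdicCompletion.eval (Ideal.span {(ℓ : ℤ)}) (Additive Kˣ) n).toAddMonoidHom

variable (ℓ) in
/-- The completion map `Kˣ → K̂`. -/
noncomputable def KHat.of (x : Kˣ) : KHat ℓ K :=
  AdicCompletion.of (Ideal.span {(ℓ : ℤ)}) (Additive Kˣ) (Additive.ofMul x)

@[ext]
theorem KHat.ext {x y : KHat ℓ K} (h : ∀ n, KHat.proj n x = KHat.proj n y) : x = y :=
  AdicCompletion.ext h

@[simp]
theorem KHat.proj_of (n : ℕ) (x : Kˣ) :
    KHat.proj n (KHat.of ℓ x) = Submodule.Quotient.mk (Additive.ofMul x) := rfl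

theorem KHat.of_mul (x y : Kˣ) : KHat.of ℓ (x * y) = KHat.of ℓ x + KHat.of ℓ y :=
  map_add (AdicCompletion.of (Ideal.span {(ℓ : ℤ)}) (Additive Kˣ)) _ _

theorem KHat.of_one : KHat.of ℓ (1 : Kˣ) = 0 :=
  map_zero (AdicCompletion.of (Ideal.span {(ℓ : ℤ)}) (Additive Kˣ))

theorem KHat.of_inv (x : Kˣ) : KHat.of ℓ x⁻¹ = -KHat.of ℓ x :=
  map_neg (AdicCompletion.of (Ideal.span {(ℓ : ℤ)}) (Additive Kˣ)) _

theorem KMod.pow_smul_eq_zero (n : ℕ) (x : KMod ℓ K n) : (ℓ ^ n) • x = 0 := by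
  induction x using Submodule.Quotient.induction_on with
  | H w =>
    rw [← Submodule.Quotient.mk_smul, Submodule.Quotient.mk_eq_zero, ← natCast_zsmul]
    refine Submodule.smul_mem_smul ?_ Submodule.mem_top
    push_cast
    exact Ideal.pow_mem_pow (Ideal.mem_span_singleton_self _) n

theorem KMod.nsmul_congr {n a b : ℕ} (h : (a : ZMod (ℓ ^ n)) = b) (x : KMod ℓ K n) :
    a • x = b • x := by
  have key : ∀ c : ℕ, c • x = (c % ℓ ^ n) • x := fun c => by
    conv_lhs => rw [← Nat.mod_add_div c (ℓ ^ n), add_nsmul, mul_comm, mul_nsmul']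
    rw [KMod.pow_smul_eq_zero, nsmul_zero, add_zero]
  rw [key a, key b, (ZMod.natCast_eq_natCast_iff' a b _).1 h]

variable [Fact ℓ.Prime]

/-- `z ∈ ℤ_ℓ` acts on the `n`-th component of `K̂` through `ℤ_ℓ → ℤ/ℓ^n`. -/
noncomputable instance : SMul ℤ_[ℓ] (KHat ℓ K) where
  smul z x := ⟨fun n => (PadicInt.toZModPow n z).val • KHat.proj n x, by
    intro m n hmn
    rw [map_nsmul]
    have h1 : AdicCompletion.transitionMap (Ideal.span {(ℓ : ℤ)}) (Additive Kˣ) hmn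
        (KHat.proj n x) = KHat.proj m x := x.2 hmn
    rw [h1]
    refine KMod.nsmul_congr ?_ _
    rw [ZMod.natCast_zmod_val, ZMod.natCast_val, PadicInt.cast_toZModPow m n hmn]⟩

theorem KHat.proj_smul (n : ℕ) (z : ℤ_[ℓ]) (x : KHat ℓ K) :
    KHat.proj n (z • x) = (PadicInt.toZModPow n z).val • KHat.proj n x := rfl

noncomputable instance : Module ℤ_[ℓ] (KHat ℓ K) where
  one_smul x := KHat.ext fun n => by
    rw [KHat.proj_smul, KMod.nsmul_congr (b := 1) (by simp), one_nsmul]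
  mul_smul a b x := KHat.ext fun n => by
    simp only [KHat.proj_smul]
    rw [← mul_nsmul']
    exact KMod.nsmul_congr (by simp) _
  smul_zero a := KHat.ext fun n => by simp [KHat.proj_smul]
  smul_add a x y := KHat.ext fun n => by simp [KHat.proj_smul]
  add_smul a b x := KHat.ext fun n => by
    simp only [KHat.proj_smul, map_add]
    rw [← add_nsmul]
    exact KMod.nsmul_congr (by simp) _
  zero_smul x := KHat.ext fun n => by simp [KHat.proj_smul]

end Completion

section ProL

variable {ℓ : ℕ} [Fact ℓ.Prime] {K : Type*} [Field K]

/-- Closedness of a submodule of `K̂ = lim Kˣ/(Kˣ)^(ℓ^n)` in the inverse limit topology (each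
`Kˣ/(Kˣ)^(ℓ^n)` being discrete): an element of `K̂` all of whose components lie in the images
of `T` belongs to `T`. -/
def IsClosedSubmodule (T : Submodule ℤ_[ℓ] (KHat ℓ K)) : Prop :=
  ∀ x : KHat ℓ K, (∀ n, ∃ t ∈ T, KHat.proj n t = KHat.proj n x) → x ∈ T

/-- `Kˣ ∩ T̂`, the inverse image of `T̂` under the completion map `Kˣ → K̂`. -/
noncomputable def unitsInter (T : Submodule ℤ_[ℓ] (KHat ℓ K)) : Subgroup Kˣ where
  carrier := {x | KHat.of ℓ x ∈ T}
  mul_mem' {x y} hx hy := by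
    change KHat.of ℓ (x * y) ∈ T
    rw [KHat.of_mul]; exact T.add_mem hx hy
  one_mem' := by
    change KHat.of ℓ (1 : Kˣ) ∈ T
    rw [KHat.of_one]; exact T.zero_mem
  inv_mem' {x} hx := by
    change KHat.of ℓ x⁻¹ ∈ T
    rw [KHat.of_inv]; exact T.neg_mem hx

/-- `M` is a cyclic `ℤ_ℓ`-module (possibly trivial). -/
def IsCyclicModule (ℓ : ℕ) [Fact ℓ.Prime] (M : Type*) [AddCommGroup M] [Module ℤ_[ℓ] M] : Prop :=
  ∃ g : M, ∀ m : M, ∃ a : ℤ_[ℓ], a • g = m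

/-- `T̂ ≤ K̂` is rigid if for all `x ∈ Kˣ` with `x ∉ T̂` the image of `⟨x, 1 - x⟩` in `K̂/T̂` is
a cyclic `ℤ_ℓ`-module. The unit `y` below is `1 - x`. -/
def IsRigidHat (T : Submodule ℤ_[ℓ] (KHat ℓ K)) : Prop :=
  ∀ x y : Kˣ, x ∉ unitsInter T → (y : K) = 1 - (x : K) →
    IsCyclicModule ℓ ((Submodule.span ℤ_[ℓ] {KHat.of ℓ x, KHat.of ℓ y}).map T.mkQ)

/-- `Ĥ` is a closed submodule containing `T̂` such that `K̂/Ĥ` is torsion-free and cyclic. -/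
def IsCocyclicOver (T H : Submodule ℤ_[ℓ] (KHat ℓ K)) : Prop :=
  T ≤ H ∧ IsClosedSubmodule H ∧ Module.IsTorsionFree ℤ_[ℓ] (KHat ℓ K ⧸ H) ∧
    IsCyclicModule ℓ (KHat ℓ K ⧸ H)

/-- The submodule `𝐇(T̂)`. -/
noncomputable def bigHHat (T : Submodule ℤ_[ℓ] (KHat ℓ K)) : Submodule ℤ_[ℓ] (KHat ℓ K) :=
  sInf {H | IsCocyclicOver T H ∧ ∀ H', IsCocyclicOver T H' → IsRigidHat (H ⊓ H')}

end ProL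

end ValRec

/-! Overgroups of `T` with cyclic quotient are kernels of characters trivial on `T`: characters to
`ℤ/ℓ` in the first half, `ℤ_ℓ`-functionals on the completion, read in `ℚ_ℓ`, in the second. Rigidity
of the intersection of two such kernels says that the determinant of the two characters at `x, 1 -
x` vanishes for all `x` (`UnitsCPair`). So `𝐇(T)` is the common kernel of the central characters,
those that pair in this way with every other one. Since characters separate points from `T`, the
assumption `T ≠ 𝐇(T)` yields characters `f, g` whose determinant at some `u, 1 - u` is nonzero.

For a central `d` and any `h`, the relation says that the points `(d, h)` at `x`, `y`, `x + y` are
collinear. The elements `1, -u, u - 1` have sum zero, lie in the kernel of `d`, and are not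
collinear under `(f, g)`. An elimination (`triangle`, `triangle_dichotomy`) then shows that for `x ∉
H = 𝐇(T)` all characters see `1 + x` either as `1` or as `x`, and similarly for `x ± u`. This is
what makes `(T, H)` a `RigidPair` (`rigidPair_of_not_cpair`).

A rigid pair yields a valuation ring by the classical construction from rigid elements: `x ∉ H` has
positive valuation when `1 + x ∈ T`, and `x ∈ H` is integral when multiplication by it preserves
these small elements. The crux is `one_sub_mul_mem`. The resulting ring is the coarsest one with
units in `H`, and `1 + 𝔪 ≤ T`.

Conversely, a character trivial on `𝒪ᵥˣ` pairs with every character trivial on `-1` and `1 + 𝔪ᵥ`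
(`unitsCPair_of_unitGroup`). Duality (`exists_character`, `exists_functional`) then shows that `H`
is no larger than what `T` and `𝒪ᵥˣ` generate. -/

namespace ValRec

/-! ### Valuation rings from rigid pairs. -/

/-- Multiplicative subgroups `T ≤ H` of a field, satisfying the conditions under which `H`
comes from a valuation whose principal units lie in `T`. -/
structure RigidPair {K : Type*} [Field K] (T H : Submonoid K) : Prop where
  zero_notMem : (0 : K) ∉ H
  le : T ≤ H
  inv_T : ∀ x ∈ T, x⁻¹ ∈ T
  inv_H : ∀ x ∈ H, x⁻¹ ∈ H
  neg_one : (-1 : K) ∈ T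
  one_add : ∀ x : K, x ≠ 0 → x ∉ H → 1 + x ∈ T ∨ 1 + x⁻¹ ∈ T
  one_sub : ∀ x : K, x ≠ 0 → x ∉ H → 1 + x ∈ T → 1 - x ∈ T
  one_add_mem : ∀ z ∈ H, z ∉ T → 1 + z ≠ 0 → 1 + z ∈ H
  exists_unit : ∃ u ∈ H, ∃ w ∈ H, u + w = 1 ∧ u ∉ T ∧ u / w ∉ T ∧
    ∀ x : K, x ≠ 0 → x ∉ H → 1 + x ∈ T → 1 + x * u ∈ T ∧ 1 + x / u ∈ T

namespace RigidPair

variable {K : Type*} [Field K] {T H : Submonoid K}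

/-- The elements of positive valuation lying outside `H`. -/
def Small (T H : Submonoid K) (x : K) : Prop := x ≠ 0 ∧ x ∉ H ∧ 1 + x ∈ T

section

variable (P : RigidPair T H)
include P

theorem ne_zero {x : K} (hx : x ∈ H) : x ≠ 0 := fun h => P.zero_notMem (h ▸ hx)

theorem mem_H_of_mul {x y : K} (hx : x ∈ H) (h : x * y ∈ H) : y ∈ H := by
  have := H.mul_mem (P.inv_H x hx) h
  rwa [inv_mul_cancel_left₀ (P.ne_zero hx)] at this

theorem mem_T_of_mul {x y : K} (hx : x ∈ T) (h : x * y ∈ T) : y ∈ T := by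
  have := T.mul_mem (P.inv_T x hx) h
  rwa [inv_mul_cancel_left₀ (P.ne_zero (P.le hx))] at this

theorem mul_notMem_H {x y : K} (hx : x ∈ H) (h : y ∉ H) : x * y ∉ H :=
  fun h' => h (P.mem_H_of_mul hx h')

theorem neg_T {x : K} (hx : x ∈ T) : -x ∈ T := by
  simpa using T.mul_mem P.neg_one hx

theorem neg_H {x : K} (hx : x ∈ H) : -x ∈ H := by
  simpa using H.mul_mem (P.le P.neg_one) hx

theorem small_neg {x : K} (h : Small T H x) : Small T H (-x) := by
  refine ⟨neg_ne_zero.2 h.1, fun h' => h.2.1 (by simpa using P.neg_H h'), ?_⟩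
  rw [← sub_eq_add_neg]
  exact P.one_sub x h.1 h.2.1 h.2.2

theorem one_sub_mem {x : K} (h : Small T H x) : 1 - x ∈ T := P.one_sub x h.1 h.2.1 h.2.2

/-- Membership of `1 + x` in the larger group `H` already decides the alternative: as `1 + x = x(1 +
x⁻¹)`, having `1 + x⁻¹ ∈ T` would put `x` in `H`. -/
theorem small_of_mem_H {x : K} (h0 : x ≠ 0) (hx : x ∉ H) (h : 1 + x ∈ H) : Small T H x := by
  refine ⟨h0, hx, (P.one_add x h0 hx).resolve_right fun h' => hx ?_⟩
  refine P.mem_H_of_mul (P.le h') ?_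
  rwa [add_mul, one_mul, inv_mul_cancel₀ h0, add_comm]

theorem small_of_one_sub {x : K} (h0 : x ≠ 0) (hx : x ∉ H) (h : 1 - x ∈ H) : Small T H x := by
  have := P.small_neg (P.small_of_mem_H (x := -x) (neg_ne_zero.2 h0)
    (fun h' => hx (by simpa using P.neg_H h')) (by rwa [← sub_eq_add_neg]))
  simpa using this

theorem small_or_inv {x : K} (h0 : x ≠ 0) (hx : x ∉ H) : Small T H x ∨ Small T H x⁻¹ :=
  (P.one_add x h0 hx).imp (fun h => ⟨h0, hx, h⟩) fun h =>
    ⟨inv_ne_zero h0, fun h' => hx (by simpa using P.inv_H _ h'), h⟩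

theorem not_small_inv {x : K} (h : Small T H x) : ¬ Small T H x⁻¹ := by
  intro h'
  apply h.2.1
  refine P.mem_H_of_mul (P.le h'.2.2) ?_
  rw [add_mul, one_mul, inv_mul_cancel₀ h.1, add_comm]
  exact P.le h.2.2

/-- If `y ∉ H` and `s, t ∈ T` then `s + y * t` lies in `T` or in `y * T`. -/
theorem add_mul_mem {y s t : K} (h0 : y ≠ 0) (h : y ∉ H) (hs : s ∈ T) (ht : t ∈ T) :
    s + y * t ∈ T ∨ y⁻¹ * (s + y * t) ∈ T := by
  have hs0 := P.ne_zero (P.le hs)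
  have ht0 := P.ne_zero (P.le ht)
  have hst : t * s⁻¹ ∈ T := T.mul_mem ht (P.inv_T s hs)
  rcases P.one_add ((t * s⁻¹) * y) (mul_ne_zero (mul_ne_zero ht0 (inv_ne_zero hs0)) h0)
    (P.mul_notMem_H (P.le hst) h) with h1 | h1
  · left
    convert T.mul_mem hs h1 using 1
    field_simp
  · right
    convert T.mul_mem ht h1 using 1
    field_simp
    ring

/-- Write `1 - yz` both as `(1 - y) + y(1 - z)` and as `(1 - z) + z(1 - y)`, and apply `add_mul_mem`
to each. -/
theorem one_sub_mul {y z : K} (hy : Small T H y) (hz : Small T H z) :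
    1 - y * z ∈ T ∨ (y⁻¹ * (1 - y * z) ∈ T ∧ z⁻¹ * (1 - y * z) ∈ T) := by
  have h1 := P.add_mul_mem hy.1 hy.2.1 (P.one_sub_mem hy) (P.one_sub_mem hz)
  have h2 := P.add_mul_mem hz.1 hz.2.1 (P.one_sub_mem hz) (P.one_sub_mem hy)
  rw [show 1 - y + y * (1 - z) = 1 - y * z by ring] at h1
  rw [show 1 - z + z * (1 - y) = 1 - y * z by ring] at h2
  tauto

theorem small_mul_unit : ∃ u ∈ H, ∃ w ∈ H, u + w = 1 ∧ u ∉ T ∧ u / w ∉ T ∧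
    ∀ x : K, Small T H x → Small T H (x * u) ∧ Small T H (x / u) := by
  obtain ⟨u, hu, w, hw, h1, h2, h3, h4⟩ := P.exists_unit
  refine ⟨u, hu, w, hw, h1, h2, h3, fun x hx => ?_⟩
  have hu0 := P.ne_zero hu
  obtain ⟨h5, h6⟩ := h4 x hx.1 hx.2.1 hx.2.2
  refine ⟨⟨mul_ne_zero hx.1 hu0, ?_, h5⟩, ⟨div_ne_zero hx.1 hu0, ?_, h6⟩⟩
  · rw [mul_comm]; exact P.mul_notMem_H hu hx.2.1
  · rw [div_eq_inv_mul]; exact P.mul_notMem_H (P.inv_H u hu) hx.2.1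

theorem add_mem_H {a b : K} (ha : a ∈ H) (hb : b ∈ H) (hab : a / b ∉ T) (h : a + b ≠ 0) :
    a + b ∈ H := by
  have hb0 := P.ne_zero hb
  have h1 : 1 + a / b ≠ 0 := fun h' => h (by field_simp at h'; linear_combination h')
  have h2 := H.mul_mem hb (P.one_add_mem (a / b)
    (by rw [div_eq_mul_inv]; exact H.mul_mem ha (P.inv_H b hb)) hab h1)
  convert h2 using 1
  field_simp
  ring

/-- The product of two small elements `y, z` satisfies `1 - y * z ∈ T`. -/
theorem one_sub_mul_mem {y z : K} (hy : Small T H y) (hz : Small T H z) : 1 - y * z ∈ T := by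
  rcases P.one_sub_mul hy hz with h | ⟨hy1, hz1⟩
  · exact h
  exfalso
  have hyz0 := mul_ne_zero hy.1 hz.1
  have hE : 1 - y * z ≠ 0 := fun h => P.zero_notMem (P.le (by simpa [h] using hy1))
  by_cases hH : y * z ∈ H
  · -- `1 - y * z ∉ H`, whereas it is the sum of two elements of `H` in different `T`-cosets
    have hnot : 1 - y * z ∉ H := fun h =>
      hy.2.1 (inv_inv y ▸ P.inv_H _ (P.mem_H_of_mul h (by
        rw [mul_comm]; exact P.le hy1)))
    obtain ⟨u, hu, w, hw, huw, huT, huwT, hsm⟩ := P.small_mul_unit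
    have hu0 := P.ne_zero hu
    have hyu := (hsm y hy).2
    -- In the exceptional case `y` and `z` lie in the same `T`-coset. Dividing `y` by `u ∉ T`
    -- destroys this, so the exception cannot also occur for `y / u` and `z`.
    have hyzT : y⁻¹ * z ∈ T := by
      have := T.mul_mem hy1 (P.inv_T _ hz1)
      convert this using 1
      field_simp
    have ht : 1 - y / u * z ∈ T := by
      rcases P.one_sub_mul hyu hz with h | ⟨ha, hb⟩
      · exact h
      exfalso
      have hE' : 1 - y / u * z ≠ 0 := fun h => P.zero_notMem (P.le (by simpa [h] using ha))
      have h1 : (y / u)⁻¹ * z ∈ T := by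
        have := T.mul_mem ha (P.inv_T _ hb)
        rwa [mul_inv, inv_inv, mul_mul_mul_comm, mul_inv_cancel₀ hE', mul_one] at this
      refine huT (P.mem_T_of_mul hyzT ?_)
      convert h1 using 1
      have := hy.1
      field_simp
    refine hnot ?_
    -- Two summands in `H` whose quotient is `u / w` up to a factor in `T`, hence not in `T`; so the
    -- sum lies in `H`.
    have hsum : 1 - y * z = u * (1 - y / u * z) + w := by
      have : u * (y / u * z) = y * z := by field_simp
      linear_combination -huw + this
    rw [hsum]
    refine P.add_mem_H (H.mul_mem hu (P.le ht)) hw (fun h => huwT ?_) (by rwa [← hsum])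
    refine P.mem_T_of_mul ht ?_
    convert h using 1
    ring
  · rcases P.one_add (-(y * z)) (neg_ne_zero.2 hyz0)
      (fun h => hH (by simpa using P.neg_H h)) with h | h
    · refine hy.2.1 ?_
      rw [← sub_eq_add_neg] at h
      rw [← inv_inv y]
      exact P.inv_H _ (P.mem_H_of_mul (P.le h) (by rw [mul_comm]; exact P.le hy1))
    · have h1 : (y * z)⁻¹ * (1 - y * z) ∈ T := by
        have h1 := P.neg_T h
        rwa [show -(1 + (-(y * z))⁻¹) = (y * z)⁻¹ * (1 - y * z) by
          rw [inv_neg, mul_sub, inv_mul_cancel₀ hyz0]; ring] at h1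
      refine hz.2.1 ?_
      have := T.mul_mem hy1 (P.inv_T _ h1)
      rw [mul_inv, inv_inv, mul_mul_mul_comm, mul_inv_cancel₀ hE, mul_one,
        inv_mul_cancel_left₀ hy.1] at this
      exact P.le this

theorem small_mul {y z : K} (hy : Small T H y) (hz : Small T H z) (h : y * z ∉ H) :
    Small T H (y * z) :=
  P.small_of_one_sub (mul_ne_zero hy.1 hz.1) h (P.le (P.one_sub_mul_mem hy hz))

/-- A product of three small elements that lies outside `H` is small. -/
theorem small_mul_mul {w y z : K} (hw : Small T H w) (hy : Small T H y) (hz : Small T H z)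
    (h : w * (y * z) ∉ H) : Small T H (w * (y * z)) := by
  by_cases h1 : w * y ∈ H
  swap
  · rw [← mul_assoc] at h ⊢
    exact P.small_mul (P.small_mul hw hy h1) hz h
  have h0 : w * (y * z) ≠ 0 := mul_ne_zero hw.1 (mul_ne_zero hy.1 hz.1)
  refine P.small_of_one_sub h0 h ?_
  -- `1 - a * b * c ∈ H` as soon as `a * b ∈ H ∖ T`
  have key : ∀ a b c : K, Small T H a → Small T H b → Small T H c → a * b ∈ H → a * b ∉ T →
      a * b * c ∉ H → 1 - a * b * c ∈ H := by
    intro a b c ha hb hc hab hT hn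
    have hT1 := P.one_sub_mul_mem ha hb
    have hT2 := P.one_sub_mem hc
    have heq : 1 - a * b * c = a * b * (1 - c) + (1 - a * b) := by ring
    rw [heq]
    refine P.add_mem_H (H.mul_mem hab (P.le hT2)) (P.le hT1) (fun h' => hT ?_) ?_
    · refine P.mem_T_of_mul hT2 (P.mem_T_of_mul (P.inv_T _ hT1) ?_)
      convert h' using 1
      ring
    · rw [← heq]
      intro h'
      apply hn
      rw [← sub_eq_zero.1 h']
      exact H.one_mem
  by_cases hT : w * y ∈ T
  · obtain ⟨u, hu, -, -, -, huT, -, hsm⟩ := P.small_mul_unit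
    have hu0 := P.ne_zero hu
    have heq : w * (y * z) = (w * u) * y * (z / u) := by field_simp
    rw [heq] at h ⊢
    refine key _ _ _ (hsm w hw).1 hy (hsm z hz).2 ?_ ?_ h
    · rw [mul_right_comm]; exact H.mul_mem h1 hu
    · rw [mul_right_comm]; exact fun h' => huT (P.mem_T_of_mul hT h')
  · rw [← mul_assoc] at h ⊢
    exact key _ _ _ hw hy hz h1 hT h

end

/-- The nonzero elements of the valuation ring attached to a rigid pair. -/
def Integral (T H : Submonoid K) (x : K) : Prop :=
  Small T H x ∨ (x ∈ H ∧ ∀ y, Small T H y → Small T H (x * y))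

section

variable (P : RigidPair T H)
include P

theorem Integral.ne_zero {x : K} (h : Integral T H x) : x ≠ 0 :=
  h.elim (fun h => h.1) fun h => P.ne_zero h.1

/-- If `y * z` falls into `H`, integrality asks about products of three small elements, which is why
`small_mul_mul` is needed. -/
theorem integral_small_mul {y z : K} (hy : Small T H y) (hz : Small T H z) :
    Integral T H (y * z) := by
  by_cases h : y * z ∈ H
  · refine .inr ⟨h, fun w hw => ?_⟩
    have := P.small_mul_mul hw hy hz (by rw [mul_comm]; exact P.mul_notMem_H h hw.2.1)
    rwa [mul_comm] at this
  · exact .inl (P.small_mul hy hz h)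

theorem integral_mul {x y : K} (hx : Integral T H x) (hy : Integral T H y) :
    Integral T H (x * y) := by
  rcases hx with hx | hx <;> rcases hy with hy | hy
  · exact P.integral_small_mul hx hy
  · rw [mul_comm]; exact .inl (hy.2 x hx)
  · exact .inl (hx.2 y hy)
  · exact .inr ⟨H.mul_mem hx.1 hy.1, fun z hz => by
      rw [mul_assoc]; exact hx.2 _ (hy.2 z hz)⟩

theorem integral_neg_one : Integral T H (-1) :=
  .inr ⟨P.le P.neg_one, fun y hy => by rw [neg_one_mul]; exact P.small_neg hy⟩

theorem small_div_one_add {y : K} (hy : Small T H y) : Small T H (y / (1 + y)) := by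
  have h1 := P.ne_zero (P.le hy.2.2)
  have h2 := P.inv_T _ hy.2.2
  refine P.small_of_one_sub (div_ne_zero hy.1 h1) ?_ (P.le ?_)
  · rw [div_eq_inv_mul]; exact P.mul_notMem_H (P.le h2) hy.2.1
  · convert h2 using 1
    field_simp
    ring

/-- If `x * y` is small for all small `y`, then so is `(1 + x) * y`, if it lies outside `H`. -/
theorem small_one_add_mul {x y : K} (hx : Integral T H x) (hxH : 1 + x ∈ H)
    (hy : Small T H y) : Small T H ((1 + x) * y) := by
  have h1 := P.ne_zero (P.le hy.2.2)
  have hy' := P.small_div_one_add hy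
  have hmem : 1 + x * (y / (1 + y)) ∈ T := by
    rcases hx with hx | hx
    · have := P.one_sub_mul_mem (P.small_neg hx) hy'
      rwa [neg_mul, sub_neg_eq_add] at this
    · exact (hx.2 _ hy').2.2
  refine P.small_of_mem_H (mul_ne_zero (P.ne_zero hxH) hy.1) (P.mul_notMem_H hxH hy.2.1)
    (P.le ?_)
  -- The point of replacing `y` by `y / (1 + y)`: `(1 + y)(1 + x · y/(1 + y)) = 1 + (1 + x)y`.
  convert T.mul_mem hy.2.2 hmem using 1
  field_simp
  ring

theorem integral_one_add {x : K} (hx : Integral T H x) (h0 : 1 + x ≠ 0) :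
    Integral T H (1 + x) := by
  by_cases hH : 1 + x ∈ H
  · exact .inr ⟨hH, fun y hy => P.small_one_add_mul hx hH hy⟩
  · rcases hx with hx | hx
    · exact absurd (P.le hx.2.2) hH
    · refine .inl (P.small_of_one_sub h0 hH ?_)
      rw [sub_add_cancel_left]
      exact P.neg_H hx.1

/-- Some small `y` has `x * y` not small; then `(x * y)⁻¹` is small and `x⁻¹ = y (x * y)⁻¹`. This
gives both the dichotomy `x` or `x⁻¹` integral and the description of the maximal ideal. -/
theorem exists_small_mul {x : K} (hx : x ∈ H) (h : ¬ Integral T H x) :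
    ∃ y z, Small T H y ∧ Small T H z ∧ x⁻¹ = y * z := by
  have : ∃ y, Small T H y ∧ ¬ Small T H (x * y) := by
    by_contra! h'
    exact h (.inr ⟨hx, h'⟩)
  obtain ⟨y, hy, hxy⟩ := this
  have hx0 := P.ne_zero hx
  refine ⟨y, (x * y)⁻¹, hy, (P.small_or_inv (mul_ne_zero hx0 hy.1)
    (P.mul_notMem_H hx hy.2.1)).resolve_left hxy, ?_⟩
  have := hy.1
  field_simp

theorem integral_or_inv {x : K} (h0 : x ≠ 0) : Integral T H x ∨ Integral T H x⁻¹ := by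
  by_cases hx : x ∈ H
  · by_contra! h
    obtain ⟨y, z, hy, hz, hyz⟩ := P.exists_small_mul hx h.1
    exact h.2 (hyz ▸ P.integral_small_mul hy hz)
  · exact (P.small_or_inv h0 hx).imp .inl .inl

theorem integral_add {x y : K} (hx : Integral T H x) (hy : Integral T H y) (h : x + y ≠ 0) :
    Integral T H (x + y) := by
  have key : ∀ a b : K, Integral T H a → Integral T H (b / a) → a + b ≠ 0 →
      Integral T H (a + b) := by
    intro a b ha hab hne
    have ha0 := Integral.ne_zero P ha
    have heq : a + b = a * (1 + b / a) := by field_simp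
    rw [heq] at hne ⊢
    exact P.integral_mul ha (P.integral_one_add hab (right_ne_zero_of_mul hne))
  have hx0 := Integral.ne_zero P hx
  have hy0 := Integral.ne_zero P hy
  rcases P.integral_or_inv (div_ne_zero hy0 hx0) with h1 | h1
  · exact key x y hx h1 h
  · rw [inv_div] at h1
    rw [add_comm] at h ⊢
    exact key y x hy h1 h

end

/-- The valuation ring attached to a rigid pair. -/
def valuationSubring (P : RigidPair T H) : ValuationSubring K where
  carrier := {x | x = 0 ∨ Integral T H x}
  mul_mem' := by
    rintro x y (rfl | hx) (rfl | hy)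
    · simp
    · simp
    · simp
    · exact .inr (P.integral_mul hx hy)
  one_mem' := .inr (by
    have := P.integral_mul P.integral_neg_one P.integral_neg_one
    simpa using this)
  add_mem' := by
    rintro x y (rfl | hx) (rfl | hy)
    · simp
    · simpa using Or.inr hy
    · simpa using Or.inr hx
    · by_cases h : x + y = 0
      · exact .inl h
      · exact .inr (P.integral_add hx hy h)
  zero_mem' := .inl rfl
  neg_mem' := by
    rintro x (rfl | hx)
    · simp
    · refine .inr ?_
      simpa using P.integral_mul P.integral_neg_one hx
  mem_or_inv_mem' x := by
    by_cases h : x = 0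
    · exact .inl (.inl h)
    · exact (P.integral_or_inv h).imp .inr .inr

theorem mem_valuationSubring (P : RigidPair T H) {x : K} :
    x ∈ P.valuationSubring ↔ x = 0 ∨ Integral T H x := Iff.rfl

theorem mem_H_of_integral (P : RigidPair T H) {x : K} (h : Integral T H x)
    (h' : Integral T H x⁻¹) : x ∈ H := by
  rcases h with h | h
  · rcases h' with h' | h'
    · exact absurd h' (P.not_small_inv h)
    · simpa using P.inv_H _ h'.1
  · exact h.1

/-- The nonzero elements of the maximal ideal are small or products of two small ones, and
`one_sub_mul_mem` covers the second case. -/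
theorem one_sub_mem_of_not_integral_inv (P : RigidPair T H) {x : K} (h0 : x ≠ 0)
    (h : ¬ Integral T H x⁻¹) : 1 - x ∈ T := by
  by_cases hx : x ∈ H
  · obtain ⟨y, z, hy, hz, hyz⟩ := P.exists_small_mul (P.inv_H x hx) h
    rw [← inv_inv x, hyz]
    exact P.one_sub_mul_mem hy hz
  · exact P.one_sub_mem ((P.small_or_inv h0 hx).resolve_right fun h' => h (.inl h'))

/-- For a valuation ring `w` with units in `H`, an element `y ∈ w` outside `H` is a nonunit, so `1 +
y` is a unit of `w`, lies in `H`, and `y` is small. Conversely small elements lie in `w`, since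
otherwise their inverses would be small too. -/
theorem isGreatest (P : RigidPair T H) :
    IsGreatest {w : ValuationSubring K | ∀ x ∈ w, x⁻¹ ∈ w → x ≠ 0 → x ∈ H}
      P.valuationSubring := by
  refine ⟨fun x hx hx' h0 => P.mem_H_of_integral (hx.resolve_left h0)
    (hx'.resolve_left (inv_ne_zero h0)), fun w hw x hx => ?_⟩
  rcases eq_or_ne x 0 with h0 | h0
  · exact .inl h0
  refine .inr ?_
  -- nonzero elements of `w` outside `H` are small
  have small_of : ∀ y ∈ w, y ≠ 0 → y ∉ H → Small T H y := by
    intro y hy hy0 hyH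
    have hy' : y⁻¹ ∉ w := fun h => hyH (hw y hy h hy0)
    refine P.small_of_mem_H hy0 hyH (hw _ (w.add_mem _ _ w.one_mem hy) ?_ ?_)
    · have h1 : 1 + y ≠ 0 := fun h => hyH (by
        rw [eq_neg_of_add_eq_zero_right h]; exact P.le P.neg_one)
      by_contra hcon
      -- Since `(1 + y)y⁻¹ = 1 + y⁻¹ ∉ w`, its inverse `y/(1 + y)` is in `w`, and so is `(1 + y)⁻¹ =
      -- 1 - y/(1 + y)`.
      have h2 := (w.mem_or_inv_mem ((1 + y) * y⁻¹)).resolve_left fun h => hy' (by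
        have := w.toSubring.sub_mem h w.one_mem
        rwa [add_mul, mul_inv_cancel₀ hy0, one_mul, add_sub_cancel_right] at this)
      have h3 : (1 + y)⁻¹ = 1 - ((1 + y) * y⁻¹)⁻¹ := by field_simp; ring
      exact hcon (h3 ▸ w.toSubring.sub_mem w.one_mem h2)
    · exact fun h => hyH (by
        rw [eq_neg_of_add_eq_zero_right h]; exact P.le P.neg_one)
  by_cases hxH : x ∈ H
  · refine .inr ⟨hxH, fun y hy => small_of _ (w.mul_mem _ _ hx ?_) (mul_ne_zero h0 hy.1)
      (P.mul_notMem_H hxH hy.2.1)⟩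
    by_contra hyw
    have := small_of y⁻¹ ((w.mem_or_inv_mem y).resolve_left hyw) (inv_ne_zero hy.1)
      fun h => hy.2.1 (by simpa using P.inv_H _ h)
    exact P.not_small_inv hy this
  · exact .inl (small_of x hx h0 hxH)

end RigidPair


/-! ### Logarithmic functions: collinearity and the passage to rigid pairs. -/

section Log

variable {K F : Type*} [Field K] [Field F]

/-- A homomorphism `Kˣ → F` killing `-1`, as a function on `K` (the value at `0` is irrelevant). -/
structure IsLog (g : K → F) : Prop where
  map_neg_one : g (-1) = 0
  map_mul : ∀ x y, x ≠ 0 → y ≠ 0 → g (x * y) = g x + g y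

/-- The determinant of `f, g` at `x, 1 - x` vanishes for all `x`. -/
def CPair (f g : K → F) : Prop := ∀ x, x ≠ 0 → 1 - x ≠ 0 → f x * g (1 - x) = f (1 - x) * g x

namespace IsLog

variable {g d : K → F}

theorem map_one (hg : IsLog g) : g 1 = 0 := by
  have := hg.map_mul 1 1 one_ne_zero one_ne_zero
  rw [mul_one] at this
  simpa using this

theorem map_inv (hg : IsLog g) {x : K} (hx : x ≠ 0) : g x⁻¹ = -g x := by
  have := hg.map_mul x x⁻¹ hx (inv_ne_zero hx)
  rw [mul_inv_cancel₀ hx, hg.map_one] at this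
  linear_combination -this

theorem map_neg (hg : IsLog g) {x : K} (hx : x ≠ 0) : g (-x) = g x := by
  have := hg.map_mul (-1) x (by simp) hx
  rwa [neg_one_mul, hg.map_neg_one, zero_add] at this

theorem map_div (hg : IsLog g) {x y : K} (hx : x ≠ 0) (hy : y ≠ 0) : g (x / y) = g x - g y := by
  rw [div_eq_mul_inv, hg.map_mul x _ hx (inv_ne_zero hy), hg.map_inv hy, sub_eq_add_neg]

/-- The homogeneous form of the relation `CPair`. -/
theorem cpair_add (hd : IsLog d) (hg : IsLog g) (h : CPair d g) {x y : K} (hx : x ≠ 0)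
    (hy : y ≠ 0) (hxy : x + y ≠ 0) :
    (d x - d y) * (g (x + y) - g y) = (d (x + y) - d y) * (g x - g y) := by
  have h1 : 1 - -(x / y) = (x + y) / y := by field_simp; ring
  have hxy' := div_ne_zero hx hy
  -- The sign introduced here is invisible to functions killing `-1`.
  have := h (-(x / y)) (neg_ne_zero.2 hxy') (by rw [h1]; exact div_ne_zero hxy hy)
  rwa [h1, hd.map_neg hxy', hg.map_neg hxy', hd.map_div hx hy, hg.map_div hx hy,
    hd.map_div hxy hy, hg.map_div hxy hy] at this

end IsLog

/-- The determinant of `1, f, g` at three points. -/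
def affineDet (f g : K → F) (p q r : K) : F :=
  (f q * g r - f r * g q) + (f r * g p - f p * g r) + (f p * g q - f q * g p)

/-- If `f, g` do not lie on a line at three points of sum zero, then for every `x` outside the
kernel of a central `d`, one of `x - p`, `x + q` looks like `x`, `q` respectively. -/
theorem triangle {W : Set (K → F)} (hW : ∀ g ∈ W, IsLog g) {d f g : K → F} (hdW : d ∈ W)
    (hd : ∀ h ∈ W, CPair d h) (hf : f ∈ W) (hg : g ∈ W) {p q r x : K}
    (hp : p ≠ 0) (hq : q ≠ 0) (hr : r ≠ 0) (hpqr : p + q + r = 0) (hdp : d p = 0)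
    (hdq : d q = 0) (hdr : d r = 0) (hdet : affineDet f g p q r ≠ 0) (hx : x ≠ 0)
    (hdx : d x ≠ 0) : (∀ h ∈ W, h (x - p) = h x) ∨ (∀ h ∈ W, h (x + q) = h q) := by
  have hdL := hW d hdW
  have hxq : x + q ≠ 0 := fun h => hdx (by
    rw [eq_neg_of_add_eq_zero_left h, hdL.map_neg hq, hdq])
  have hxp : x + -p ≠ 0 := fun h => hdx (by
    rw [eq_neg_of_add_eq_zero_left h, neg_neg, hdp])
  have hdnp : d (-p) = 0 := by rw [hdL.map_neg hp, hdp]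
  have hsum : x + q + r = x + -p := by linear_combination hpqr
  -- Three collinearities, for `x + q`, for `x - p = x + (-p)`, and for `x - p = (x + q) + r`.
  have h1 : ∀ h ∈ W, d x * (h (x + q) - h q) = d (x + q) * (h x - h q) := fun h hh => by
    simpa [hdq] using hdL.cpair_add (hW h hh) (hd h hh) hx hq hxq
  have h2 : ∀ h ∈ W, d x * (h (x + -p) - h p) = d (x + -p) * (h x - h p) := fun h hh => by
    simpa [hdnp, (hW h hh).map_neg hp] using
      hdL.cpair_add (hW h hh) (hd h hh) hx (neg_ne_zero.2 hp) hxp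
  have h3 : ∀ h ∈ W, d (x + q) * (h (x + -p) - h r) = d (x + -p) * (h (x + q) - h r) :=
    fun h hh => by
      have := hdL.cpair_add (hW h hh) (hd h hh) hxq hr (by rw [hsum]; exact hxp)
      simpa [hdr, hsum] using this
  by_cases hc : d (x + q) = 0
  · right
    intro h hh
    have := h1 h hh
    rw [hc, zero_mul] at this
    exact sub_eq_zero.1 ((mul_eq_zero.1 this).resolve_left hdx)
  left
  -- relation between the values at `p, q, r`
  set c := d (x + q) with hcdef
  set k := d (x + -p) with hkdef
  set e := d x with hedef
  have h4 : ∀ h ∈ W, e * (c - k) * h r + k * (e - c) * h q + c * (k - e) * h p = 0 := by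
    intro h hh
    linear_combination c * h2 h hh - e * h3 h hh - k * h1 h hh
  have hf4 := h4 f hf
  have hg4 := h4 g hg
  -- The coefficients in `h4` do not depend on `h` and have sum zero, so `h4` is an affine
  -- dependence between the `(f, g)`-points of `p, q, r`. These are not collinear, so the
  -- coefficient of `h p` vanishes.
  have h5 : c * (k - e) * affineDet f g p q r = 0 := by
    unfold affineDet
    linear_combination (g r - g q) * hf4 * (-1) + (f r - f q) * hg4
  have hk : k = e := by
    have := (mul_eq_zero.1 h5).resolve_right hdet
    exact sub_eq_zero.1 ((mul_eq_zero.1 this).resolve_left hc)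
  intro h hh
  have := h2 h hh
  rw [hk] at this
  have := mul_left_cancel₀ hdx this
  rw [sub_eq_add_neg]
  exact sub_left_injective this

/-- For `x` outside the kernel of a central `d`, either all `x ± p, x ± q, x ± r` look like `x`,
or they look like `p, q, r`. -/
theorem triangle_dichotomy {W : Set (K → F)} (hW : ∀ g ∈ W, IsLog g) {d f g : K → F} (hdW : d ∈ W)
    (hd : ∀ h ∈ W, CPair d h) (hf : f ∈ W) (hg : g ∈ W) {p : Fin 3 → K}
    (hp : ∀ i, p i ≠ 0) (hsum : p 0 + p 1 + p 2 = 0) (hdp : ∀ i, d (p i) = 0)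
    (hdet : affineDet f g (p 0) (p 1) (p 2) ≠ 0) {x : K} (hx : x ≠ 0) (hdx : d x ≠ 0) :
    (∀ i, ∀ h ∈ W, h (x + p i) = h x ∧ h (x - p i) = h x) ∨
      (∀ i, ∀ h ∈ W, h (x + p i) = h (p i) ∧ h (x - p i) = h (p i)) := by
  have hdL := hW d hdW
  have tri : ∀ i j, i ≠ j → ∀ y, y ≠ 0 → d y ≠ 0 →
      (∀ h ∈ W, h (y - p i) = h y) ∨ (∀ h ∈ W, h (y + p j) = h (p j)) := by
    intro i j hij y hy hdy
    obtain ⟨k, hs, hk⟩ : ∃ k, p i + p j + p k = 0 ∧ affineDet f g (p i) (p j) (p k) ≠ 0 := by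
      have e1 : affineDet f g (p 1) (p 2) (p 0) = affineDet f g (p 0) (p 1) (p 2) := by
        unfold affineDet; ring
      have e2 : affineDet f g (p 2) (p 0) (p 1) = affineDet f g (p 0) (p 1) (p 2) := by
        unfold affineDet; ring
      have e3 : affineDet f g (p 1) (p 0) (p 2) = -affineDet f g (p 0) (p 1) (p 2) := by
        unfold affineDet; ring
      have e4 : affineDet f g (p 0) (p 2) (p 1) = -affineDet f g (p 0) (p 1) (p 2) := by
        unfold affineDet; ring
      have e5 : affineDet f g (p 2) (p 1) (p 0) = -affineDet f g (p 0) (p 1) (p 2) := by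
        unfold affineDet; ring
      have hdet' := neg_ne_zero.2 hdet
      fin_cases i <;> fin_cases j
      · exact absurd rfl hij
      · exact ⟨2, hsum, hdet⟩
      · exact ⟨1, .trans (by dsimp; ring) hsum, e4 ▸ hdet'⟩
      · exact ⟨2, .trans (by dsimp; ring) hsum, e3 ▸ hdet'⟩
      · exact absurd rfl hij
      · exact ⟨0, .trans (by dsimp; ring) hsum, e1 ▸ hdet⟩
      · exact ⟨1, .trans (by dsimp; ring) hsum, e2 ▸ hdet⟩
      · exact ⟨0, .trans (by dsimp; ring) hsum, e5 ▸ hdet'⟩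
      · exact absurd rfl hij
    exact triangle hW hdW hd hf hg (hp i) (hp j) (hp k) hs (hdp i) (hdp j) (hdp k) hk hy hdy
  have hnx : -x ≠ 0 := neg_ne_zero.2 hx
  have hdnx : d (-x) ≠ 0 := by rwa [hdL.map_neg hx]
  have hadd : ∀ i, x + p i ≠ 0 := fun i h => hdx (by
    rw [eq_neg_of_add_eq_zero_left h, hdL.map_neg (hp i), hdp])
  have hsub : ∀ i, x - p i ≠ 0 := fun i h => hdx (by rw [sub_eq_zero.1 h, hdp])
  -- `tri` for `-x`, which exchanges the roles of `+` and `-`.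
  have tri' : ∀ i j, i ≠ j →
      (∀ h ∈ W, h (x + p i) = h x) ∨ (∀ h ∈ W, h (x - p j) = h (p j)) := by
    intro i j hij
    refine (tri i j hij (-x) hnx hdnx).imp (fun H h hh => ?_) fun H h hh => ?_
    · have := H h hh
      rwa [(hW h hh).map_neg hx, show -x - p i = -(x + p i) by ring,
        (hW h hh).map_neg (hadd i)] at this
    · have := H h hh
      rwa [show -x + p j = -(x - p j) by ring, (hW h hh).map_neg (hsub j)] at this
  -- the two alternatives exclude each other
  have excl : ∀ i, (∀ h ∈ W, h (x + p i) = h (p i)) → ¬ ∀ h ∈ W, h (x + p i) = h x :=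
    fun i h1 h2 => hdx (by rw [← h2 d hdW, h1 d hdW, hdp])
  have excl' : ∀ i, (∀ h ∈ W, h (x - p i) = h (p i)) → ¬ ∀ h ∈ W, h (x - p i) = h x :=
    fun i h1 h2 => hdx (by rw [← h2 d hdW, h1 d hdW, hdp])
  obtain ⟨j, k, hj, hk, hjk, hcov⟩ : ∃ j k : Fin 3, 0 ≠ j ∧ 0 ≠ k ∧ j ≠ k ∧
      ∀ i, i = 0 ∨ i = j ∨ i = k := ⟨1, 2, by decide, by decide, by decide, by decide⟩
  -- The behaviour of `x - p 0` decides everything: each use of `tri` or `tri'` with one alternative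
  -- excluded propagates it to another index and sign.
  by_cases h0 : ∀ h ∈ W, h (x - p 0) = h x
  · left
    have A : ∀ i, 0 ≠ i → ∀ h ∈ W, h (x + p i) = h x := fun i hi =>
      (tri' i 0 hi.symm).resolve_right fun h => excl' 0 h h0
    have A' : ∀ l m, 0 ≠ l → m ≠ l → ∀ h ∈ W, h (x - p m) = h x := fun l m hl hml =>
      (tri m l hml x hx hdx).resolve_right fun h => excl l h (A l hl)
    have Aj := A' k j hk hjk
    have Ak := A' j k hj hjk.symm
    have A0 : ∀ h ∈ W, h (x + p 0) = h x :=
      (tri' 0 j hj).resolve_right fun h => excl' j h Aj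
    intro i h hh
    rcases hcov i with rfl | rfl | rfl
    · exact ⟨A0 h hh, h0 h hh⟩
    · exact ⟨A _ hj h hh, Aj h hh⟩
    · exact ⟨A _ hk h hh, Ak h hh⟩
  · right
    have B : ∀ i, 0 ≠ i → ∀ h ∈ W, h (x + p i) = h (p i) := fun i hi =>
      (tri 0 i hi x hx hdx).resolve_left h0
    have B' : ∀ l m, 0 ≠ l → l ≠ m → ∀ h ∈ W, h (x - p m) = h (p m) := fun l m hl hlm =>
      (tri' l m hlm).resolve_left (excl l (B l hl))
    have Bj := B' k j hk hjk.symm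
    have Bk := B' j k hj hjk
    have B0' : ∀ h ∈ W, h (x - p 0) = h (p 0) := B' j 0 hj hj.symm
    have B0 : ∀ h ∈ W, h (x + p 0) = h (p 0) :=
      (tri j 0 hj.symm x hx hdx).resolve_left (excl' j Bj)
    intro i h hh
    rcases hcov i with rfl | rfl | rfl
    · exact ⟨B0 h hh, B0' h hh⟩
    · exact ⟨B _ hj h hh, Bj h hh⟩
    · exact ⟨B _ hk h hh, Bk h hh⟩

/-- The central part of a family of logarithms that are not all `CPair`s defines a rigid pair. -/
theorem rigidPair_of_not_cpair {W : Set (K → F)} (hW : ∀ g ∈ W, IsLog g) {T H : Submonoid K}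
    (hT : ∀ x, x ∈ T ↔ x ≠ 0 ∧ ∀ g ∈ W, g x = 0)
    (hH : ∀ x, x ∈ H ↔ x ≠ 0 ∧ ∀ d ∈ W, (∀ g ∈ W, CPair d g) → d x = 0)
    {f g : K → F} (hf : f ∈ W) (hg : g ∈ W) (hfg : ¬ CPair f g) : RigidPair T H := by
  simp only [CPair, not_forall] at hfg
  obtain ⟨u, hu0, hw0, hdet⟩ := hfg
  have hfL := hW f hf
  have hgL := hW g hg
  -- The vectors of values of `f` and `g` at `(u, 1 - u)` are independent, and that of a central `d`
  -- is proportional to both, hence zero.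
  have hdu : ∀ d ∈ W, (∀ g ∈ W, CPair d g) → d u = 0 ∧ d (1 - u) = 0 := by
    intro d hd hdC
    have h1 := hdC f hf u hu0 hw0
    have h2 := hdC g hg u hu0 hw0
    constructor
    · by_contra h
      apply hdet
      apply mul_left_cancel₀ h
      linear_combination f u * h2 - g u * h1
    · by_contra h
      apply hdet
      apply mul_left_cancel₀ h
      linear_combination f (1 - u) * h2 - g (1 - u) * h1
  have notMem : ∀ x, x ≠ 0 → x ∉ H → ∃ d ∈ W, (∀ g ∈ W, CPair d g) ∧ d x ≠ 0 := by
    intro x hx hxH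
    by_contra! h
    exact hxH ((hH x).2 ⟨hx, h⟩)
  have of_mem_T : ∀ x ∈ T, ∀ g ∈ W, g x = 0 := fun x hx => ((hT x).1 hx).2
  have uH : u ∈ H := (hH u).2 ⟨hu0, fun d hd hdC => (hdu d hd hdC).1⟩
  have wH : 1 - u ∈ H := (hH _).2 ⟨hw0, fun d hd hdC => (hdu d hd hdC).2⟩
  have uT : u ∉ T := fun h => hdet (by rw [of_mem_T u h f hf, of_mem_T u h g hg]; ring)
  have uwT : u / (1 - u) ∉ T := fun h => hdet (by
    have h1 := of_mem_T _ h f hf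
    have h2 := of_mem_T _ h g hg
    rw [hfL.map_div hu0 hw0] at h1
    rw [hgL.map_div hu0 hw0] at h2
    linear_combination g (1 - u) * h1 - f (1 - u) * h2)
  -- the dichotomy for `1, -u, u - 1`
  have dich : ∀ x, x ≠ 0 → x ∉ H →
      (∀ h ∈ W, h (1 + x) = h x ∧ h (x + u) = h x) ∨
      (∀ h ∈ W, h (1 + x) = 0 ∧ h (1 - x) = 0 ∧ h (x + u) = h u ∧ h (x - u) = h u) := by
    intro x hx hxH
    obtain ⟨d, hd, hdC, hdx⟩ := notMem x hx hxH
    obtain ⟨hd1, hd2⟩ := hdu d hd hdC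
    have hdL := hW d hd
    have := triangle_dichotomy hW hd hdC hf hg (p := ![1, -u, -(1 - u)])
      (by
        intro i
        fin_cases i
        · exact one_ne_zero
        · exact neg_ne_zero.2 hu0
        · exact neg_ne_zero.2 hw0)
      (by
        change 1 + -u + -(1 - u) = 0
        ring)
      (by
        intro i
        fin_cases i
        · exact hdL.map_one
        · exact (hdL.map_neg hu0).trans hd1
        · exact (hdL.map_neg hw0).trans hd2)
      (by
        change affineDet f g 1 (-u) (-(1 - u)) ≠ 0
        intro h
        apply hdet
        unfold affineDet at h
        rw [hfL.map_one, hgL.map_one, hfL.map_neg hu0, hgL.map_neg hu0, hfL.map_neg hw0,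
          hgL.map_neg hw0] at h
        linear_combination h) hx hdx
    refine this.imp (fun hA h hh => ?_) fun hB h hh => ?_
    · have h0 := (hA 0 h hh).1
      have h1 := (hA 1 h hh).2
      simp only [Matrix.cons_val_zero, Matrix.cons_val_one, sub_neg_eq_add] at h0 h1
      exact ⟨by rwa [add_comm], h1⟩
    · have h0 := hB 0 h hh
      have h1 := hB 1 h hh
      have hL := hW h hh
      simp only [Matrix.cons_val_zero, Matrix.cons_val_one, hL.map_one, hL.map_neg hu0,
        sub_neg_eq_add, ← sub_eq_add_neg] at h0 h1
      refine ⟨by rw [add_comm]; exact h0.1, ?_, h1.2, h1.1⟩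
      rw [← neg_sub, hL.map_neg (fun h => hxH ?_)]
      · exact h0.2
      · rw [sub_eq_zero.1 h]
        exact H.one_mem
  have hle : T ≤ H := fun x hx => (hH x).2 ⟨((hT x).1 hx).1, fun d hd _ => of_mem_T x hx d hd⟩
  have neg_one : (-1 : K) ∈ T := (hT _).2 ⟨by simp, fun g hg => (hW g hg).map_neg_one⟩
  have add_ne : ∀ a x, a ∈ H → x ∉ H → a + x ≠ 0 := fun a x ha hx h => hx (by
    rw [eq_neg_of_add_eq_zero_right h, ← neg_one_mul]
    exact H.mul_mem (hle neg_one) ha)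
  refine ⟨fun h => ((hH 0).1 h).1 rfl, hle, fun x hx => ?_, fun x hx => ?_, neg_one,
    fun x hx hxH => ?_, fun x hx hxH h1 => ?_, fun z hzH hzT hz => ?_,
    u, uH, 1 - u, wH, by ring, uT, uwT, fun x hx hxH h1 => ?_⟩
  · have hx' := (hT x).1 hx
    exact (hT _).2 ⟨inv_ne_zero hx'.1, fun g hg => by
      rw [(hW g hg).map_inv hx'.1, hx'.2 g hg, neg_zero]⟩
  · have hx' := (hH x).1 hx
    exact (hH _).2 ⟨inv_ne_zero hx'.1, fun d hd hdC => by
      rw [(hW d hd).map_inv hx'.1, hx'.2 d hd hdC, neg_zero]⟩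
  · have h1x := add_ne 1 x H.one_mem hxH
    refine (dich x hx hxH).symm.imp (fun h => (hT _).2 ⟨h1x, fun g hg => (h g hg).1⟩)
      fun h => (hT _).2 ?_
    have heq : 1 + x⁻¹ = (1 + x) / x := by field_simp; ring
    rw [heq]
    exact ⟨div_ne_zero h1x hx, fun g hg => by
      rw [(hW g hg).map_div h1x hx, (h g hg).1, sub_self]⟩
  -- If `1 + x ∈ T`, the alternative that `1 + x` looks like `x` would give `d x = 0` for all
  -- central `d`, so `x ∈ H`. The goal about `z` involves no such `x` and is left as it is.
  all_goals try
    have hB := (dich x hx hxH).resolve_left fun h => hxH ((hH x).2 ⟨hx, fun d hd _ => by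
      rw [← (h d hd).1, of_mem_T _ h1 d hd]⟩)
  · refine (hT _).2 ⟨fun h => hxH ?_, fun g hg => (hB g hg).2.1⟩
    rw [← sub_eq_zero.1 h]
    exact H.one_mem
  · have hz0 := ((hH z).1 hzH).1
    refine (hH _).2 ⟨hz, fun d hd hdC => by_contra fun hne => hzT ((hT z).2 ⟨hz0, fun g hg => ?_⟩)⟩
    -- As `d` vanishes at `1` and `z`, collinearity at `1, z, 1 + z` reduces to `d (1 + z) * g z =
    -- 0`.
    have := (hW d hd).cpair_add (hW g hg) (hdC g hg) one_ne_zero hz0 hz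
    rw [(hW d hd).map_one, (hW g hg).map_one, ((hH z).1 hzH).2 d hd hdC, sub_self, zero_mul] at this
    have h2 : d (1 + z) * g z = 0 := by linear_combination this
    exact (mul_eq_zero.1 h2).resolve_left hne
  · have hxu : x + u ≠ 0 := by rw [add_comm]; exact add_ne u x uH hxH
    have h2 : 1 + x / u = (x + u) / u := by field_simp; ring
    have hxuH : x * u ∉ H := fun h => hxH (by
      have hinv : u⁻¹ ∈ H := (hH _).2 ⟨inv_ne_zero hu0, fun d hd hdC => by
        rw [(hW d hd).map_inv hu0, (hdu d hd hdC).1, neg_zero]⟩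
      have := H.mul_mem h hinv
      rwa [mul_inv_cancel_right₀ hu0] at this)
    have hxu0 := mul_ne_zero hx hu0
    refine ⟨(hT _).2 ⟨add_ne 1 _ H.one_mem hxuH, ?_⟩, (hT _).2 ⟨?_, fun g hg => ?_⟩⟩
    · rcases dich (x * u) hxu0 hxuH with h | h
      swap
      · exact fun g hg => (h g hg).1
      -- Here `x * u + u = (1 + x) * u` would look like `x * u`, so `1 + x` would look like `x` to
      -- every central `d`, whereas `1 + x ∈ T`.
      refine absurd ((hH x).2 ⟨hx, fun d hd _ => ?_⟩) hxH
      have h3 := (h d hd).2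
      have hdL := hW d hd
      rw [show x * u + u = (1 + x) * u by ring, hdL.map_mul x u hx hu0,
        hdL.map_mul (1 + x) u (add_ne 1 x H.one_mem hxH) hu0, of_mem_T _ h1 d hd] at h3
      linear_combination -h3
    · rw [h2]; exact div_ne_zero hxu hu0
    · rw [h2, (hW g hg).map_div hxu hu0, (hB g hg).2.2.1, sub_self]

end Log


/-! ### Characters of the unit group and the valuations they define. -/

section Characters

variable {K F : Type*} [Field K] [Field F]

/-- The determinant of `φ, ψ` at `x, 1 - x` vanishes for all `x`. -/
def UnitsCPair (φ ψ : Additive Kˣ →+ F) : Prop :=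
  ∀ x y : Kˣ, (y : K) = 1 - x → φ (.ofMul x) * ψ (.ofMul y) = φ (.ofMul y) * ψ (.ofMul x)

open Classical in
/-- The extension by zero of a homomorphism on units. -/
noncomputable def extendZero (φ : Additive Kˣ →+ F) (x : K) : F :=
  if h : x = 0 then 0 else φ (.ofMul (Units.mk0 x h))

theorem extendZero_coe (φ : Additive Kˣ →+ F) (x : Kˣ) : extendZero φ (x : K) = φ (.ofMul x) := by
  simp [extendZero]

theorem isLog_extendZero {φ : Additive Kˣ →+ F} (h : φ (.ofMul (-1)) = 0) :
    IsLog (extendZero φ) where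
  map_neg_one := by
    have := extendZero_coe φ (-1)
    rwa [h, Units.val_neg, Units.val_one] at this
  map_mul x y hx hy := by
    have := extendZero_coe φ (Units.mk0 x hx * Units.mk0 y hy)
    rw [ofMul_mul, map_add, ← extendZero_coe, ← extendZero_coe] at this
    exact this

theorem cpair_extendZero {φ ψ : Additive Kˣ →+ F} :
    CPair (extendZero φ) (extendZero ψ) ↔ UnitsCPair φ ψ := by
  constructor
  · intro h x y hxy
    have := h x x.ne_zero (hxy ▸ y.ne_zero)
    rwa [← hxy, extendZero_coe, extendZero_coe, extendZero_coe, extendZero_coe] at this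
  · intro h x hx hx1
    have := h (Units.mk0 x hx) (Units.mk0 _ hx1) rfl
    rwa [← extendZero_coe, ← extendZero_coe, ← extendZero_coe, ← extendZero_coe] at this

/-- The common core of both halves, used with `F = ℤ/ℓ` and `F = ℚ_ℓ`. -/
theorem isCanonicalValuation_of_not_unitsCPair {L : Set (Additive Kˣ →+ F)}
    (hneg : ∀ φ ∈ L, φ (.ofMul (-1)) = 0) {T H : Subgroup Kˣ}
    (hT : ∀ x, x ∈ T ↔ ∀ φ ∈ L, φ (.ofMul x) = 0)
    (hH : ∀ x, x ∈ H ↔ ∀ φ ∈ L, (∀ ψ ∈ L, UnitsCPair φ ψ) → φ (.ofMul x) = 0)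
    {φ ψ : Additive Kˣ →+ F} (hφ : φ ∈ L) (hψ : ψ ∈ L) (hφψ : ¬ UnitsCPair φ ψ) :
    ∃ v : ValuationSubring K, IsCanonicalValuation H v ∧ v.principalUnitGroup ≤ T := by
  have coe_mem : ∀ (S : Subgroup Kˣ) (x : Kˣ), (x : K) ∈ S.ofUnits ↔ x ∈ S := fun S x =>
    ⟨fun ⟨y, hy, h⟩ => Units.ext h ▸ hy, fun h => ⟨x, h, rfl⟩⟩
  have P : RigidPair T.ofUnits H.ofUnits := by
    refine rigidPair_of_not_cpair (W := extendZero '' L) ?_ ?_ ?_ ⟨φ, hφ, rfl⟩ ⟨ψ, hψ, rfl⟩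
      (by rwa [cpair_extendZero])
    · rintro _ ⟨φ, hφ, rfl⟩
      exact isLog_extendZero (hneg φ hφ)
    · intro x
      rcases eq_or_ne x 0 with rfl | hx
      · simpa using fun h : (0 : K) ∈ T.ofUnits => by obtain ⟨y, -, hy⟩ := h; exact y.ne_zero hy
      · lift x to Kˣ using hx.isUnit
        simp [coe_mem, hT, extendZero_coe]
    · intro x
      rcases eq_or_ne x 0 with rfl | hx
      · simpa using fun h : (0 : K) ∈ H.ofUnits => by obtain ⟨y, -, hy⟩ := h; exact y.ne_zero hy
      · lift x to Kˣ using hx.isUnit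
        simp [coe_mem, hH, extendZero_coe, cpair_extendZero]
  refine ⟨P.valuationSubring, ⟨?_, ?_⟩, fun x hx => ?_⟩
  · intro x hx
    rw [← coe_mem]
    rw [ValuationSubring.mem_unitGroup_iff] at hx
    refine P.isGreatest.1 x ((ValuationSubring.valuation_le_one_iff _ _).1 hx.le)
      ((ValuationSubring.valuation_le_one_iff _ _).1 ?_) x.ne_zero
    rw [map_inv₀, hx, inv_one]
  · intro w hw
    refine P.isGreatest.2 fun x hx hx' h0 => ?_
    lift x to Kˣ using h0.isUnit
    rw [coe_mem]
    apply hw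
    rw [ValuationSubring.mem_unitGroup_iff]
    refine le_antisymm ((ValuationSubring.valuation_le_one_iff _ _).2 hx) ?_
    have := (ValuationSubring.valuation_le_one_iff _ _).2 hx'
    rwa [map_inv₀, inv_le_one₀ (by simp [zero_lt_iff])] at this
  · rw [ValuationSubring.mem_principalUnitGroup_iff] at hx
    rw [← coe_mem]
    rcases eq_or_ne (1 - (x : K)) 0 with h0 | h0
    · rw [← sub_eq_zero.1 h0]
      exact T.ofUnits.one_mem
    have := P.one_sub_mem_of_not_integral_inv (x := 1 - x) h0 fun h => ?_
    · rwa [sub_sub_cancel] at this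
    · have h1 : (1 - (x : K))⁻¹ ∈ P.valuationSubring := P.mem_valuationSubring.2 (.inr h)
      rw [← ValuationSubring.valuation_le_one_iff, map_inv₀,
        inv_le_one₀ (by simpa [zero_lt_iff] using h0), ← Valuation.map_neg, neg_sub] at h1
      exact absurd hx h1.not_gt

/-- By the ultrametric inequality, up to sign, one of `x`, `1 - x`, `(1 - x)/x` is a principal unit,
or else both `x` and `1 - x` are units and `φ` kills them. -/
theorem unitsCPair_of_unitGroup {φ ψ : Additive Kˣ →+ F} {v : ValuationSubring K}
    (hψ : ψ (.ofMul (-1)) = 0) (hφv : ∀ x ∈ v.unitGroup, φ (.ofMul x) = 0)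
    (hψv : ∀ x ∈ v.principalUnitGroup, ψ (.ofMul x) = 0) : UnitsCPair φ ψ := by
  intro x y hxy
  have hφ' : ∀ x ∈ v.principalUnitGroup, φ (.ofMul x) = 0 := fun x hx =>
    hφv x (v.principal_units_le_units hx)
  have hφ : φ (.ofMul (-1)) = 0 := hφv _ (by simp [ValuationSubring.mem_unitGroup_iff])
  rcases lt_trichotomy (v.valuation x) 1 with h | h | h
  · have hy : y ∈ v.principalUnitGroup := by
      rw [ValuationSubring.mem_principalUnitGroup_iff, hxy, sub_sub_cancel_left,
        Valuation.map_neg]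
      exact h
    rw [hφ' y hy, hψv y hy, mul_zero, zero_mul]
  · have hx := hφv x (by rwa [ValuationSubring.mem_unitGroup_iff])
    rw [hx, zero_mul]
    have hy : v.valuation y ≤ 1 := by
      rw [hxy]
      exact (Valuation.map_sub _ _ _).trans (by simp [h])
    rcases hy.lt_or_eq with hy | hy
    · rw [hψv x, mul_zero]
      rwa [ValuationSubring.mem_principalUnitGroup_iff, ← Valuation.map_neg, neg_sub, ← hxy]
    · rw [hφv y (by rwa [ValuationSubring.mem_unitGroup_iff]), zero_mul]
  · have hz : (-1) * (x⁻¹ * y) ∈ v.principalUnitGroup := by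
      rw [ValuationSubring.mem_principalUnitGroup_iff]
      have : (((-1) * (x⁻¹ * y) : Kˣ) : K) - 1 = -((x : K)⁻¹) := by
        push_cast
        rw [hxy]
        field_simp
        ring
      rw [this, Valuation.map_neg, map_inv₀]
      exact inv_lt_one_of_one_lt₀ h
    have h1 := hφ' _ hz
    have h2 := hψv _ hz
    simp only [ofMul_mul, map_add, ofMul_inv, map_neg, hφ, hψ] at h1 h2
    linear_combination φ (.ofMul x) * h2 - ψ (.ofMul x) * h1

end Characters

/-! ### The first half: subgroups containing the `ℓ`-th powers. -/

section ModL

variable {K : Type*} [Field K] {ℓ : ℕ} [Fact ℓ.Prime]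

/-- The subgroup of units killed by a homomorphism. -/
def unitsKer {A : Type*} [AddCommGroup A] (φ : Additive Kˣ →+ A) : Subgroup Kˣ where
  carrier := {x | φ (.ofMul x) = 0}
  mul_mem' {x y} hx hy := by
    change φ (.ofMul (x * y)) = 0
    rw [ofMul_mul, map_add, show φ (.ofMul x) = 0 from hx, show φ (.ofMul y) = 0 from hy, add_zero]
  one_mem' := map_zero φ
  inv_mem' {x} hx := by
    change φ (.ofMul x⁻¹) = 0
    rw [ofMul_inv, map_neg, show φ (.ofMul x) = 0 from hx, neg_zero]

theorem mem_unitsKer {A : Type*} [AddCommGroup A] {φ : Additive Kˣ →+ A} {x : Kˣ} :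
    x ∈ unitsKer φ ↔ φ (.ofMul x) = 0 := Iff.rfl

/-- A subgroup containing the `ℓ`-th powers is separated from a unit outside it by a character
to `ℤ/ℓ`. -/
theorem exists_character {T : Subgroup Kˣ} (hT : ∀ x : Kˣ, x ^ ℓ ∈ T) {x : Kˣ} (hx : x ∉ T) :
    ∃ φ : Additive Kˣ →+ ZMod ℓ, (∀ t ∈ T, φ (.ofMul t) = 0) ∧ φ (.ofMul x) ≠ 0 := by
  have hV : ∀ v : Additive (Kˣ ⧸ T), ℓ • v = 0 := fun v => by
    obtain ⟨z, hz⟩ := QuotientGroup.mk_surjective v.toMul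
    rw [← ofMul_toMul v, ← hz]
    exact congrArg Additive.ofMul ((QuotientGroup.eq_one_iff _).2 (hT z))
  let _ := AddCommGroup.zmodModule (n := ℓ) (G := Additive (Kˣ ⧸ T)) hV
  have hx' : Additive.ofMul (x : Kˣ ⧸ T) ≠ 0 := fun h =>
    hx ((QuotientGroup.eq_one_iff _).1 h)
  have hdual : ∃ f : Module.Dual (ZMod ℓ) (Additive (Kˣ ⧸ T)), f (Additive.ofMul (x : Kˣ ⧸ T)) ≠ 0 := by
    by_contra! h
    exact hx' ((Module.forall_dual_apply_eq_zero_iff (ZMod ℓ) _).1 h)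
  obtain ⟨f, hf⟩ := hdual
  refine ⟨f.toAddMonoidHom.comp (QuotientGroup.mk' T).toAdditive, fun t ht => ?_, hf⟩
  change f (Additive.ofMul (t : Kˣ ⧸ T)) = 0
  rw [(QuotientGroup.eq_one_iff t).2 ht, ofMul_one, map_zero]

/-- A generator `z` outside `H` is detected by some character trivial on `H`; its value at `z ^ k`
vanishes only when `ℓ ∣ k`, that is, when `z ^ k ∈ H`. -/
theorem exists_unitsKer_eq {H : Subgroup Kˣ} (hH : ∀ x : Kˣ, x ^ ℓ ∈ H)
    [hc : IsCyclic (Kˣ ⧸ H)] : ∃ φ : Additive Kˣ →+ ZMod ℓ, unitsKer φ = H := by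
  obtain ⟨g, hg⟩ := hc.exists_generator
  induction g using QuotientGroup.induction_on with | _ z =>
  have hz : ∀ x : Kˣ, ∃ k : ℤ, (z ^ k)⁻¹ * x ∈ H := fun x => by
    obtain ⟨k, hk⟩ := hg x
    exact ⟨k, QuotientGroup.eq.1 hk⟩
  by_cases hzH : z ∈ H
  · refine ⟨0, le_antisymm (fun x _ => ?_) fun x _ => rfl⟩
    obtain ⟨k, hk⟩ := hz x
    simpa using H.mul_mem (H.zpow_mem hzH k) hk
  · obtain ⟨φ, hφ, hφz⟩ := exists_character hH hzH
    refine ⟨φ, le_antisymm (fun x hx => ?_) hφ⟩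
    obtain ⟨k, hk⟩ := hz x
    have h1 := hφ _ hk
    rw [mem_unitsKer] at hx
    rw [ofMul_mul, map_add, hx, ofMul_inv, map_neg, ofMul_zpow, map_zsmul, add_zero, neg_eq_zero,
      zsmul_eq_mul] at h1
    have h2 := (mul_eq_zero.1 h1).resolve_right hφz
    rw [ZMod.intCast_zmod_eq_zero_iff_dvd] at h2
    obtain ⟨m, rfl⟩ := h2
    have h3 : z ^ ((ℓ : ℤ) * m) ∈ H := by
      rw [zpow_mul, zpow_natCast]
      exact H.zpow_mem (hH z) m
    simpa using H.mul_mem h3 hk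

theorem isCyclic_quotient_unitsKer (φ : Additive Kˣ →+ ZMod ℓ) : IsCyclic (Kˣ ⧸ unitsKer φ) := by
  let f : Kˣ →* Multiplicative (ZMod ℓ) := AddMonoidHom.toMultiplicativeRight φ
  refine isCyclic_of_injective (QuotientGroup.lift (unitsKer φ) f fun x hx => hx) ?_
  rw [injective_iff_map_eq_one]
  intro q hq
  induction q using QuotientGroup.induction_on with | _ x =>
  exact (QuotientGroup.eq_one_iff x).2 hq

/-- The quotient by the intersection embeds into `(ℤ/ℓ)²` through `(φ, ψ)`, where the subgroup
generated by two vectors is cyclic exactly when they are linearly dependent. -/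
theorem isRigid_inf_unitsKer_iff (φ ψ : Additive Kˣ →+ ZMod ℓ) :
    IsRigid (unitsKer φ ⊓ unitsKer ψ) ↔ UnitsCPair φ ψ := by
  set N := unitsKer φ ⊓ unitsKer ψ
  have memN : ∀ x, x ∈ N ↔ φ (.ofMul x) = 0 ∧ ψ (.ofMul x) = 0 := fun x => Iff.rfl
  constructor
  · intro h x y hxy
    by_cases hx : x ∈ N
    · rw [((memN x).1 hx).1, ((memN x).1 hx).2, zero_mul, mul_zero]
    have hcyc : IsCyclic ((Subgroup.closure {x, y}).map (QuotientGroup.mk' N)) := h x y hx hxy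
    obtain ⟨q, hg⟩ := hcyc.exists_zpow_surjective
    obtain ⟨z, -, hz⟩ := q.2
    have key : ∀ w ∈ ({x, y} : Set Kˣ), ∃ k : ℤ, φ (.ofMul w) = k * φ (.ofMul z) ∧
        ψ (.ofMul w) = k * ψ (.ofMul z) := by
      intro w hw
      obtain ⟨k, hk⟩ := hg ⟨QuotientGroup.mk' N w, w, Subgroup.subset_closure hw, rfl⟩
      have hk' : ((z ^ k : Kˣ) : Kˣ ⧸ N) = w := by
        have := congrArg Subtype.val hk
        simp only [SubgroupClass.coe_zpow, ← hz] at this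
        exact this
      have h1 := (memN _).1 (QuotientGroup.eq.1 hk')
      simp only [ofMul_mul, map_add, ofMul_inv, map_neg, ofMul_zpow, map_zsmul,
        zsmul_eq_mul] at h1
      exact ⟨k, by linear_combination h1.1, by linear_combination h1.2⟩
    obtain ⟨a, ha, ha'⟩ := key x (by simp)
    obtain ⟨b, hb, hb'⟩ := key y (by simp)
    rw [ha, ha', hb, hb']
    ring
  · intro h x y hx hxy
    have hdet := h x y hxy
    obtain ⟨c, hc, hc'⟩ : ∃ c : ZMod ℓ, φ (.ofMul y) = c * φ (.ofMul x) ∧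
        ψ (.ofMul y) = c * ψ (.ofMul x) := by
      by_cases h1 : φ (.ofMul x) = 0
      · have h2 : ψ (.ofMul x) ≠ 0 := fun h2 => hx ((memN x).2 ⟨h1, h2⟩)
        refine ⟨ψ (.ofMul y) / ψ (.ofMul x), ?_, by field_simp⟩
        field_simp
        linear_combination -hdet
      · refine ⟨φ (.ofMul y) / φ (.ofMul x), by field_simp, ?_⟩
        field_simp
        linear_combination hdet
    obtain ⟨k, rfl⟩ := ZMod.intCast_surjective c
    have hy : QuotientGroup.mk' N y = QuotientGroup.mk' N x ^ k := by
      refine Eq.trans ?_ (map_zpow (QuotientGroup.mk' N) x k)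
      refine (QuotientGroup.eq.2 ((memN _).2 ?_)).symm
      simp only [ofMul_mul, map_add, ofMul_inv, map_neg, ofMul_zpow, map_zsmul, zsmul_eq_mul]
      exact ⟨by linear_combination hc, by linear_combination hc'⟩
    have hle : (Subgroup.closure {x, y}).map (QuotientGroup.mk' N) ≤
        Subgroup.zpowers (QuotientGroup.mk' N x) := by
      rw [Subgroup.map_le_iff_le_comap, Subgroup.closure_le]
      rintro w (rfl | rfl)
      · exact Subgroup.mem_zpowers _
      · exact ⟨k, hy.symm⟩
    exact isCyclic_of_injective (Subgroup.inclusion hle) (Subgroup.inclusion_injective hle)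

theorem mem_bigH_iff {T : Subgroup Kˣ} (hT : ∀ x : Kˣ, x ^ ℓ ∈ T) (x : Kˣ) :
    x ∈ bigH T ↔ ∀ φ : Additive Kˣ →+ ZMod ℓ, T ≤ unitsKer φ →
      (∀ ψ : Additive Kˣ →+ ZMod ℓ, T ≤ unitsKer ψ → UnitsCPair φ ψ) → φ (.ofMul x) = 0 := by
  rw [bigH, Subgroup.mem_sInf]
  constructor
  · intro h φ hφ hC
    refine h (unitsKer φ) ⟨hφ, isCyclic_quotient_unitsKer φ, fun H' hH' hcyc => ?_⟩
    obtain ⟨ψ, rfl⟩ := exists_unitsKer_eq (ℓ := ℓ) (H := H') fun x => hH' (hT x)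
    exact (isRigid_inf_unitsKer_iff φ ψ).2 (hC ψ hH')
  · rintro h H ⟨hTH, hcyc, hrig⟩
    obtain ⟨φ, rfl⟩ := exists_unitsKer_eq (ℓ := ℓ) (H := H) fun x => hTH (hT x)
    exact h φ hTH fun ψ hψ =>
      (isRigid_inf_unitsKer_iff φ ψ).1 (hrig _ hψ (isCyclic_quotient_unitsKer ψ))

variable (ℓ) in
theorem exists_isCanonicalValuation_bigH {T : Subgroup Kˣ} (hT : ∀ x : Kˣ, x ^ ℓ ∈ T)
    (hneg : (-1 : Kˣ) ∈ T) (hne : T ≠ bigH T) :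
    ∃ v : ValuationSubring K, IsCanonicalValuation (bigH T) v ∧
      v.principalUnitGroup ≤ T ∧ T ⊔ v.unitGroup = bigH T := by
  have hTle : T ≤ bigH T := le_sInf fun H hH => hH.1
  have sep : ∀ x, x ∈ T ↔ ∀ φ ∈ {φ : Additive Kˣ →+ ZMod ℓ | T ≤ unitsKer φ},
      φ (.ofMul x) = 0 := by
    refine fun x => ⟨fun hx φ hφ => hφ hx, fun h => by_contra fun hx => ?_⟩
    obtain ⟨φ, hφ, hφx⟩ := exists_character hT hx
    exact hφx (h φ hφ)
  obtain ⟨φ, hφ, ψ, hψ, hφψ⟩ : ∃ φ : Additive Kˣ →+ ZMod ℓ, T ≤ unitsKer φ ∧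
      ∃ ψ : Additive Kˣ →+ ZMod ℓ, T ≤ unitsKer ψ ∧ ¬ UnitsCPair φ ψ := by
    -- If all characters paired, all would be central, and their common kernel `T` would be `bigH
    -- T`.
    by_contra! h
    exact hne (le_antisymm hTle fun x hx =>
      (sep x).2 fun φ hφ => (mem_bigH_iff hT x).1 hx φ hφ (h φ hφ))
  obtain ⟨v, hv, hvT⟩ := isCanonicalValuation_of_not_unitsCPair
    (L := {φ : Additive Kˣ →+ ZMod ℓ | T ≤ unitsKer φ}) (fun φ hφ => hφ hneg) sep
    (mem_bigH_iff hT) hφ hψ hφψ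
  refine ⟨v, hv, hvT, le_antisymm (sup_le hTle hv.1) fun x hx => by_contra fun hx' => ?_⟩
  -- A character trivial on `T` and on `𝒪ᵥˣ` is central, hence kills `bigH T`.
  obtain ⟨χ, hχ, hχx⟩ := exists_character (T := T ⊔ v.unitGroup)
    (fun x => (le_sup_left : T ≤ _) (hT x)) hx'
  have hχT : T ≤ unitsKer χ := fun t ht => hχ t ((le_sup_left : T ≤ _) ht)
  exact hχx ((mem_bigH_iff hT x).1 hx χ hχT fun ω hω => unitsCPair_of_unitGroup (hω hneg)
    (fun y hy => hχ y ((le_sup_right : v.unitGroup ≤ _) hy)) fun y hy => hω (hvT hy))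

end ModL


/-! ### Functionals on torsion-free, separated `ℤ_ℓ`-modules. -/

section Functional

universe u

variable {ℓ : ℕ} [Fact ℓ.Prime] {M : Type u} [AddCommGroup M] [Module ℤ_[ℓ] M]

theorem prime_ne_zero_padicInt : (ℓ : ℤ_[ℓ]) ≠ 0 :=
  Nat.cast_ne_zero.2 (Fact.out : ℓ.Prime).ne_zero

theorem finsupp_eq_smul_of_dvd {R ι : Type*} [CommRing R] [IsDomain R] {a : R} (ha : a ≠ 0)
    {c : ι →₀ R} (h : ∀ i, a ∣ c i) : ∃ c' : ι →₀ R, c = a • c' := by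
  choose f hf using h
  refine ⟨Finsupp.onFinset c.support f fun i hi => ?_, Finsupp.ext fun i => ?_⟩
  · rw [Finsupp.mem_support_iff, hf i]
    exact mul_ne_zero ha hi
  · simpa using hf i

theorem padicInt_eq_of_pow_dvd_sub {x y : ℤ_[ℓ]} (h : ∀ n, (ℓ : ℤ_[ℓ]) ^ n ∣ x - y) : x = y := by
  rw [← sub_eq_zero]
  refine IsHausdorff.haus (I := IsLocalRing.maximalIdeal ℤ_[ℓ]) inferInstance _ fun n => ?_
  rw [SModEq.zero, smul_eq_mul, Ideal.mul_top, PadicInt.maximalIdeal_eq_span_p,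
    Ideal.span_singleton_pow, Ideal.mem_span_singleton]
  exact h n

theorem padicInt_exists_limit (f : ℕ → ℤ_[ℓ])
    (h : ∀ {m n : ℕ}, m ≤ n → (ℓ : ℤ_[ℓ]) ^ m ∣ f m - f n) :
    ∃ z, ∀ n, (ℓ : ℤ_[ℓ]) ^ n ∣ f n - z := by
  have key : ∀ (n : ℕ) (x y : ℤ_[ℓ]),
      x ≡ y [SMOD (IsLocalRing.maximalIdeal ℤ_[ℓ] ^ n • ⊤ : Submodule ℤ_[ℓ] ℤ_[ℓ])] ↔
        (ℓ : ℤ_[ℓ]) ^ n ∣ x - y := fun n x y => by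
    rw [SModEq.sub_mem, smul_eq_mul, Ideal.mul_top, PadicInt.maximalIdeal_eq_span_p,
      Ideal.span_singleton_pow, Ideal.mem_span_singleton]
  obtain ⟨z, hz⟩ := IsPrecomplete.prec (I := IsLocalRing.maximalIdeal ℤ_[ℓ])
    (inferInstance : IsPrecomplete _ ℤ_[ℓ]) (f := f) fun hmn => (key _ _ _).2 (h hmn)
  exact ⟨z, fun n => (key _ _ _).1 (hz n)⟩

variable (ℓ M) in
/-- A lift of a basis of `M / ℓ`. -/
theorem exists_basis_mod : ∃ (ι : Type u) (b : ι → M),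
    (∀ m : M, ∃ (c : ι →₀ ℤ_[ℓ]) (m' : M),
      m = Finsupp.linearCombination ℤ_[ℓ] b c + (ℓ : ℤ_[ℓ]) • m') ∧
    ∀ (c : ι →₀ ℤ_[ℓ]) (m' : M), Finsupp.linearCombination ℤ_[ℓ] b c = (ℓ : ℤ_[ℓ]) • m' →
      ∀ i, (ℓ : ℤ_[ℓ]) ∣ c i := by
  let I : Ideal ℤ_[ℓ] := IsLocalRing.maximalIdeal ℤ_[ℓ]
  let _ : Field (ℤ_[ℓ] ⧸ I) := Ideal.Quotient.field I
  let N : Submodule ℤ_[ℓ] M := I • ⊤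
  have memN : ∀ m, m ∈ N ↔ ∃ m', m = (ℓ : ℤ_[ℓ]) • m' := fun m => by
    simp only [N, I, PadicInt.maximalIdeal_eq_span_p, Submodule.ideal_span_singleton_smul,
      Submodule.mem_smul_pointwise_iff_exists, Submodule.mem_top, true_and, eq_comm]
  let B := Module.Basis.ofVectorSpace (ℤ_[ℓ] ⧸ I) (M ⧸ N)
  choose b hb using fun i => N.mkQ_surjective (B i)
  have hrepr : ∀ c : _ →₀ ℤ_[ℓ], B.repr (N.mkQ (Finsupp.linearCombination ℤ_[ℓ] b c)) =
      c.mapRange (Ideal.Quotient.mk I) (map_zero _) := by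
    intro c
    induction c using Finsupp.induction_linear with
    | zero => simp
    | add c d hc hd =>
      rw [map_add, map_add, map_add, hc, hd, Finsupp.mapRange_add (fun x y => map_add _ x y)]
    | single i r =>
      rw [Finsupp.linearCombination_single, map_smul, hb, Finsupp.mapRange_single,
        ← Ideal.Quotient.mk_eq_mk, show r • B i = (Ideal.Quotient.mk I r) • B i from rfl,
        map_smul, B.repr_self, Finsupp.smul_single, smul_eq_mul, mul_one]
      rfl
  refine ⟨_, b, fun m => ?_, fun c m' h i => ?_⟩
  · obtain ⟨c, hc⟩ := Finsupp.mapRange_surjective (Ideal.Quotient.mk I) (map_zero _)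
      Ideal.Quotient.mk_surjective (B.repr (N.mkQ m))
    rw [← hrepr] at hc
    have h1 := B.repr.injective hc
    rw [eq_comm, ← sub_eq_zero, ← map_sub, Submodule.mkQ_apply, Submodule.Quotient.mk_eq_zero,
      memN] at h1
    obtain ⟨m', hm'⟩ := h1
    exact ⟨c, m', by rw [← hm']; abel⟩
  · have h1 := hrepr c
    rw [Submodule.mkQ_apply, (Submodule.Quotient.mk_eq_zero N).2 ((memN _).2 ⟨m', h⟩), map_zero] at h1
    have h2 := DFunLike.congr_fun h1 i
    rw [Finsupp.mapRange_apply, Finsupp.zero_apply, eq_comm, Ideal.Quotient.eq_zero_iff_mem] at h2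
    have h3 : c i ∈ IsLocalRing.maximalIdeal ℤ_[ℓ] := h2
    rwa [PadicInt.maximalIdeal_eq_span_p, Ideal.mem_span_singleton] at h3

/-- Linear functionals separate the points of a torsion-free `ℓ`-adically separated module. -/
theorem exists_linearMap_ne_zero [Module.IsTorsionFree ℤ_[ℓ] M]
    (hsep : ∀ m : M, (∀ n : ℕ, ∃ m', m = (ℓ : ℤ_[ℓ]) ^ n • m') → m = 0) {m : M} (hm : m ≠ 0) :
    ∃ φ : M →ₗ[ℤ_[ℓ]] ℤ_[ℓ], φ m ≠ 0 := by
  obtain ⟨ι, b, hspan, hind⟩ := exists_basis_mod ℓ M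
  set p := (ℓ : ℤ_[ℓ])
  have hp0 : p ≠ 0 := prime_ne_zero_padicInt
  set L := Finsupp.linearCombination ℤ_[ℓ] b
  have hspan' : ∀ (n : ℕ) (m : M), ∃ (c : ι →₀ ℤ_[ℓ]) (m' : M), m = L c + p ^ n • m' := by
    intro n
    induction n with
    | zero => exact fun m => ⟨0, m, by simp⟩
    | succ n ih =>
      intro m
      obtain ⟨c, m', h⟩ := ih m
      obtain ⟨c', m'', h'⟩ := hspan m'
      refine ⟨c + p ^ n • c', m'', ?_⟩
      rw [h, h', map_add, map_smul, smul_add, pow_succ, mul_smul, add_assoc]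
  -- Independence modulo `ℓ` lifts to independence modulo `ℓ ^ n` because torsion-freeness allows
  -- cancelling `ℓ`. So coordinates modulo `ℓ ^ n` are well defined, and their limits are the
  -- functionals sought.
  have hind' : ∀ (n : ℕ) (c : ι →₀ ℤ_[ℓ]) (m' : M), L c = p ^ n • m' → ∀ i, p ^ n ∣ c i := by
    intro n
    induction n with
    | zero => exact fun c m' _ i => by simp
    | succ n ih =>
      intro c m' h i
      rw [pow_succ', mul_smul] at h
      obtain ⟨c', rfl⟩ := finsupp_eq_smul_of_dvd hp0 (hind c _ h)
      rw [map_smul] at h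
      rw [pow_succ', Finsupp.smul_apply, smul_eq_mul]
      exact mul_dvd_mul_left p (ih c' m' (smul_right_injective M hp0 h) i)
  have hcongr : ∀ (n : ℕ) (c d : ι →₀ ℤ_[ℓ]) (m x y : M), m = L c + p ^ n • x →
      m = L d + p ^ n • y → ∀ i, p ^ n ∣ c i - d i := by
    intro n c d m x y h1 h2 i
    refine hind' n (c - d) (y - x) ?_ i
    rw [map_sub, smul_sub, sub_eq_sub_iff_add_eq_add, ← h1, h2, add_comm]
  -- the `i`-th coordinate, as a relation
  let Rel : ι → M → ℤ_[ℓ] → Prop := fun i m z =>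
    ∀ n, ∃ c x, m = L c + p ^ n • x ∧ p ^ n ∣ z - c i
  have hex : ∀ i m, ∃ z, Rel i m z := by
    intro i m
    choose c x h using fun n => hspan' n m
    obtain ⟨z, hz⟩ := padicInt_exists_limit (fun n => c n i) fun {k n} hkn =>
      hcongr k (c k) (c n) m (x k) (p ^ (n - k) • x n) (h k) (by
        rw [← mul_smul, ← pow_add, Nat.add_sub_cancel' hkn]; exact h n) i
    exact ⟨z, fun n => ⟨c n, x n, h n, (dvd_sub_comm).1 (hz n)⟩⟩
  have huniq : ∀ i m z z', Rel i m z → Rel i m z' → z = z' := by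
    refine fun i m z z' h h' => padicInt_eq_of_pow_dvd_sub fun n => ?_
    obtain ⟨c, x, h1, h2⟩ := h n
    obtain ⟨d, y, h3, h4⟩ := h' n
    have := dvd_add (dvd_sub h2 h4) (hcongr n c d m x y h1 h3 i)
    convert this using 1
    ring
  choose φ hφ using hex
  let Φ : ι → M →ₗ[ℤ_[ℓ]] ℤ_[ℓ] := fun i =>
    { toFun := φ i
      map_add' := fun m m' => huniq i (m + m') _ _ (hφ i _) fun n => by
        obtain ⟨c, x, h1, h2⟩ := hφ i m n
        obtain ⟨d, y, h3, h4⟩ := hφ i m' n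
        refine ⟨c + d, x + y, ?_, ?_⟩
        · conv_lhs => rw [h1, h3]
          rw [map_add, smul_add]
          abel
        · rw [Finsupp.add_apply, add_sub_add_comm]
          exact dvd_add h2 h4
      map_smul' := fun r m => huniq i (r • m) _ _ (hφ i _) fun n => by
        obtain ⟨c, x, h1, h2⟩ := hφ i m n
        refine ⟨r • c, r • x, ?_, ?_⟩
        · conv_lhs => rw [h1]
          rw [map_smul, smul_add, smul_comm]
        · rw [Finsupp.smul_apply, RingHom.id_apply, smul_eq_mul, smul_eq_mul, ← mul_sub]
          exact h2.mul_left r }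
  -- If all coordinates of `m` vanish, then `m` is divisible by every `ℓ ^ n`, contrary to
  -- separatedness.
  by_contra! hall
  refine hm (hsep m fun n => ?_)
  obtain ⟨c, x, h⟩ := hspan' n m
  have hdvd : ∀ i, p ^ n ∣ c i := fun i => by
    obtain ⟨d, y, h1, h2⟩ := hφ i m n
    rw [show φ i m = 0 from hall (Φ i), zero_sub, dvd_neg] at h2
    have := dvd_add (hcongr n c d m x y h h1 i) h2
    rwa [sub_add_cancel] at this
  obtain ⟨c', rfl⟩ := finsupp_eq_smul_of_dvd (pow_ne_zero n hp0) hdvd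
  exact ⟨L c' + x, by rw [h, map_smul, smul_add]⟩

end Functional


/-! ### The second half: closed submodules of the completion. -/

section ProL

variable {ℓ : ℕ} [Fact ℓ.Prime] {K : Type*} [Field K]

theorem padicInt_pow_smul (n : ℕ) (y : KHat ℓ K) : (ℓ : ℤ_[ℓ]) ^ n • y = (ℓ ^ n) • y := by
  rw [← Nat.cast_pow, Nat.cast_smul_eq_nsmul]

theorem proj_pow_smul (n : ℕ) (y : KHat ℓ K) : KHat.proj n ((ℓ : ℤ_[ℓ]) ^ n • y) = 0 := by
  rw [padicInt_pow_smul, map_nsmul, KMod.pow_smul_eq_zero]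

/-- The ideal `(ℓ)` is finitely generated, so the inverse limit topology of the completion is its
`ℓ`-adic topology. Hence functionals are automatically continuous and closedness of a submodule
gives an `ℓ`-adically separated quotient. -/
theorem exists_eq_pow_smul {n : ℕ} {x : KHat ℓ K} (h : KHat.proj n x = 0) :
    ∃ y, x = (ℓ : ℤ_[ℓ]) ^ n • y := by
  have hfg : (Ideal.span {(ℓ : ℤ)}).FG := ⟨{(ℓ : ℤ)}, by simp⟩
  have h1 : (show AdicCompletion (Ideal.span {(ℓ : ℤ)}) (Additive Kˣ) from x) ∈
      ((Ideal.span {(ℓ : ℤ)}) ^ n • ⊤ :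
        Submodule ℤ (AdicCompletion (Ideal.span {(ℓ : ℤ)}) (Additive Kˣ))) := by
    rw [AdicCompletion.pow_smul_top_eq_ker_eval hfg]
    exact h
  rw [Ideal.span_singleton_pow, Submodule.ideal_span_singleton_smul,
    Submodule.mem_smul_pointwise_iff_exists] at h1
  obtain ⟨y, -, hy⟩ := h1
  refine ⟨y, Eq.trans (hy.symm.trans ?_) (padicInt_pow_smul (K := K) n y).symm⟩
  rw [← Nat.cast_pow]
  exact natCast_zsmul y _

theorem isClosedSubmodule_ker (φ : KHat ℓ K →ₗ[ℤ_[ℓ]] ℤ_[ℓ]) : IsClosedSubmodule φ.ker := by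
  refine fun x hx => padicInt_eq_of_pow_dvd_sub fun n => ?_
  obtain ⟨t, ht, htx⟩ := hx n
  obtain ⟨y, hy⟩ := exists_eq_pow_smul (n := n) (x := x - t) (by rw [map_sub, htx, sub_self])
  rw [sub_zero, eq_add_of_sub_eq hy, map_add, LinearMap.mem_ker.1 ht, add_zero, map_smul]
  exact ⟨φ y, rfl⟩

theorem isTorsionFree_quotient_ker (φ : KHat ℓ K →ₗ[ℤ_[ℓ]] ℤ_[ℓ]) :
    Module.IsTorsionFree ℤ_[ℓ] (KHat ℓ K ⧸ φ.ker) :=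
  Function.Injective.moduleIsTorsionFree (φ.ker.liftQ φ le_rfl)
    (LinearMap.ker_eq_bot.1 (Submodule.ker_liftQ_eq_bot _ _ _ le_rfl))
    fun r x => map_smul _ r x

theorem isCyclicModule_quotient_ker (φ : KHat ℓ K →ₗ[ℤ_[ℓ]] ℤ_[ℓ]) :
    IsCyclicModule ℓ (KHat ℓ K ⧸ φ.ker) := by
  obtain ⟨g, hg⟩ := (IsPrincipalIdealRing.principal (R := ℤ_[ℓ]) φ.range).principal
  obtain ⟨x, hx⟩ : g ∈ φ.range := hg ▸ Submodule.mem_span_singleton_self g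
  refine ⟨φ.ker.mkQ x, fun m => ?_⟩
  obtain ⟨y, rfl⟩ := φ.ker.mkQ_surjective m
  have hy : φ y ∈ φ.range := ⟨y, rfl⟩
  rw [hg, Submodule.mem_span_singleton] at hy
  obtain ⟨a, ha⟩ := hy
  refine ⟨a, ?_⟩
  rw [← map_smul, ← sub_eq_zero, ← map_sub, Submodule.mkQ_apply, Submodule.Quotient.mk_eq_zero,
    LinearMap.mem_ker, map_sub, map_smul, hx, ha, sub_self]

/-- Linear functionals separate the points from a closed submodule with torsion-free quotient. -/
theorem exists_functional {S : Submodule ℤ_[ℓ] (KHat ℓ K)} (hS : IsClosedSubmodule S)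
    (htf : Module.IsTorsionFree ℤ_[ℓ] (KHat ℓ K ⧸ S)) {x : KHat ℓ K} (hx : x ∉ S) :
    ∃ φ : KHat ℓ K →ₗ[ℤ_[ℓ]] ℤ_[ℓ], S ≤ φ.ker ∧ φ x ≠ 0 := by
  have hsep : ∀ m : KHat ℓ K ⧸ S, (∀ n : ℕ, ∃ m', m = (ℓ : ℤ_[ℓ]) ^ n • m') → m = 0 := by
    intro m hm
    obtain ⟨z, rfl⟩ := S.mkQ_surjective m
    refine (Submodule.Quotient.mk_eq_zero S).2 (hS z fun n => ?_)
    obtain ⟨m', hm'⟩ := hm n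
    obtain ⟨y, rfl⟩ := S.mkQ_surjective m'
    rw [← map_smul, ← sub_eq_zero, ← map_sub, Submodule.mkQ_apply,
      Submodule.Quotient.mk_eq_zero] at hm'
    exact ⟨_, hm', by rw [map_sub, proj_pow_smul, sub_zero]⟩
  obtain ⟨φ, hφ⟩ := exists_linearMap_ne_zero hsep (m := S.mkQ x)
    fun h => hx ((Submodule.Quotient.mk_eq_zero S).1 h)
  refine ⟨φ.comp S.mkQ, fun y hy => ?_, hφ⟩
  rw [LinearMap.mem_ker, LinearMap.comp_apply, Submodule.mkQ_apply,
    (Submodule.Quotient.mk_eq_zero S).2 hy, map_zero]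

theorem isCocyclicOver_ker {T : Submodule ℤ_[ℓ] (KHat ℓ K)} {φ : KHat ℓ K →ₗ[ℤ_[ℓ]] ℤ_[ℓ]}
    (h : T ≤ φ.ker) : IsCocyclicOver T φ.ker :=
  ⟨h, isClosedSubmodule_ker φ, isTorsionFree_quotient_ker φ, isCyclicModule_quotient_ker φ⟩

/-- A functional that kills `H` but not a generator `z` of the quotient has kernel exactly `H`,
because `ℤ_ℓ` is a domain. -/
theorem IsCocyclicOver.exists_ker_eq {T H : Submodule ℤ_[ℓ] (KHat ℓ K)}
    (h : IsCocyclicOver T H) : ∃ φ : KHat ℓ K →ₗ[ℤ_[ℓ]] ℤ_[ℓ], φ.ker = H := by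
  obtain ⟨-, hcl, htf, g, hg⟩ := h
  obtain ⟨z, rfl⟩ := H.mkQ_surjective g
  have hz : ∀ x, ∃ a : ℤ_[ℓ], x - a • z ∈ H := fun x => by
    obtain ⟨a, ha⟩ := hg (H.mkQ x)
    refine ⟨a, ?_⟩
    rw [← Submodule.Quotient.mk_eq_zero H, ← Submodule.mkQ_apply, map_sub, map_smul, ha, sub_self]
  by_cases hzH : z ∈ H
  · refine ⟨0, le_antisymm (fun x _ => ?_) fun x _ => rfl⟩
    obtain ⟨a, ha⟩ := hz x
    simpa using H.add_mem ha (H.smul_mem a hzH)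
  · obtain ⟨φ, hφ, hφz⟩ := exists_functional hcl htf hzH
    refine ⟨φ, le_antisymm (fun x hx => ?_) hφ⟩
    obtain ⟨a, ha⟩ := hz x
    have h1 := hφ ha
    rw [LinearMap.mem_ker, map_sub, map_smul, LinearMap.mem_ker.1 hx, zero_sub, neg_eq_zero,
      smul_eq_mul] at h1
    rw [(mul_eq_zero.1 h1).resolve_right hφz, zero_smul, sub_zero] at ha
    exact ha

/-- The `ℚ_ℓ`-valued character of `Kˣ` attached to a functional on the completion. -/
noncomputable def unitsChar (φ : KHat ℓ K →ₗ[ℤ_[ℓ]] ℤ_[ℓ]) : Additive Kˣ →+ ℚ_[ℓ] where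
  toFun x := (φ (KHat.of ℓ x.toMul) : ℚ_[ℓ])
  map_zero' := by simp [KHat.of_one]
  map_add' x y := by simp [KHat.of_mul]

theorem unitsChar_apply (φ : KHat ℓ K →ₗ[ℤ_[ℓ]] ℤ_[ℓ]) (x : Kˣ) :
    unitsChar φ (.ofMul x) = (φ (KHat.of ℓ x) : ℚ_[ℓ]) := rfl

theorem unitsChar_eq_zero_iff (φ : KHat ℓ K →ₗ[ℤ_[ℓ]] ℤ_[ℓ]) (x : Kˣ) :
    unitsChar φ (.ofMul x) = 0 ↔ KHat.of ℓ x ∈ φ.ker := by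
  rw [unitsChar_apply, LinearMap.mem_ker, PadicInt.coe_eq_zero]

theorem isRigidHat_inf_ker_iff (φ ψ : KHat ℓ K →ₗ[ℤ_[ℓ]] ℤ_[ℓ]) :
    IsRigidHat (φ.ker ⊓ ψ.ker) ↔ UnitsCPair (unitsChar φ) (unitsChar ψ) := by
  set N := φ.ker ⊓ ψ.ker
  have memN : ∀ x, x ∈ N ↔ φ x = 0 ∧ ψ x = 0 := fun x => Iff.rfl
  have memU : ∀ x, x ∈ unitsInter N ↔ φ (.of ℓ x) = 0 ∧ ψ (.of ℓ x) = 0 := fun x => Iff.rfl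
  have hcp : UnitsCPair (unitsChar φ) (unitsChar ψ) ↔ ∀ x y : Kˣ, (y : K) = 1 - x →
      φ (.of ℓ x) * ψ (.of ℓ y) = φ (.of ℓ y) * ψ (.of ℓ x) := by
    simp only [UnitsCPair, unitsChar_apply, ← PadicInt.coe_mul]
    exact forall₃_congr fun _ _ _ => Subtype.coe_inj
  have hmk : ∀ u w : KHat ℓ K, N.mkQ u = N.mkQ w ↔ φ u = φ w ∧ ψ u = ψ w := fun u w => by
    rw [← sub_eq_zero, ← map_sub, Submodule.mkQ_apply, Submodule.Quotient.mk_eq_zero, memN,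
      map_sub, map_sub, sub_eq_zero, sub_eq_zero]
  rw [hcp]
  constructor
  · intro h x y hxy
    by_cases hx : x ∈ unitsInter N
    · rw [((memU x).1 hx).1, ((memU x).1 hx).2, zero_mul, mul_zero]
    obtain ⟨q, hq⟩ := h x y hx hxy
    obtain ⟨z, -, hz⟩ := q.2
    have key : ∀ w ∈ ({KHat.of ℓ x, KHat.of ℓ y} : Set (KHat ℓ K)), ∃ a : ℤ_[ℓ],
        φ w = a * φ z ∧ ψ w = a * ψ z := by
      intro w hw
      obtain ⟨a, ha⟩ := hq ⟨N.mkQ w, w, Submodule.subset_span hw, rfl⟩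
      have h1 : a • (q : KHat ℓ K ⧸ N) = N.mkQ w := congrArg Subtype.val ha
      rw [← hz, ← map_smul, hmk, map_smul, map_smul] at h1
      exact ⟨a, h1.1.symm, h1.2.symm⟩
    obtain ⟨a, ha, ha'⟩ := key _ (Set.mem_insert _ _)
    obtain ⟨b, hb, hb'⟩ := key _ (Set.mem_insert_of_mem _ rfl)
    rw [ha, ha', hb, hb']
    ring
  · intro h x y hx hxy
    have hdet := h x y hxy
    set X := KHat.of ℓ x
    set Y := KHat.of ℓ y
    -- one of `X, Y` is a multiple of the other
    have hdvd : (∃ c : ℤ_[ℓ], N.mkQ Y = c • N.mkQ X) ∨ ∃ c : ℤ_[ℓ], N.mkQ X = c • N.mkQ Y := by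
      have aux : ∀ f g : KHat ℓ K →ₗ[ℤ_[ℓ]] ℤ_[ℓ], f X * g Y = f Y * g X → f X ≠ 0 →
          (∃ c : ℤ_[ℓ], f Y = c * f X ∧ g Y = c * g X) ∨
            ∃ c : ℤ_[ℓ], f X = c * f Y ∧ g X = c * g Y := by
        intro f g hfg hf
        -- Over `ℤ_ℓ` proportional vectors need not be multiples of a prescribed one of them, but
        -- divisibility is total, so one is a multiple of the other.
        rcases ValuationRing.dvd_total (f X) (f Y) with ⟨c, hc⟩ | ⟨c, hc⟩
        · refine .inl ⟨c, by rw [hc, mul_comm], mul_left_cancel₀ hf ?_⟩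
          rw [hfg, hc]
          ring
        · have hfY : f Y ≠ 0 := fun h => hf (by rw [hc, h, zero_mul])
          refine .inr ⟨c, by rw [hc, mul_comm], mul_left_cancel₀ hfY ?_⟩
          rw [← hfg, hc]
          ring
      by_cases h1 : φ X = 0
      · have h2 : ψ X ≠ 0 := fun h2 => hx ((memU x).2 ⟨h1, h2⟩)
        refine (aux ψ φ (by linear_combination -hdet) h2).imp ?_ ?_ <;>
        · rintro ⟨c, hc, hc'⟩
          exact ⟨c, by rw [← map_smul, hmk, map_smul, map_smul]; exact ⟨hc', hc⟩⟩
      · refine (aux φ ψ hdet h1).imp ?_ ?_ <;>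
        · rintro ⟨c, hc, hc'⟩
          exact ⟨c, by rw [← map_smul, hmk, map_smul, map_smul]; exact ⟨hc, hc'⟩⟩
    have hmap : (Submodule.span ℤ_[ℓ] {X, Y}).map N.mkQ =
        Submodule.span ℤ_[ℓ] {N.mkQ X, N.mkQ Y} := by
      rw [Submodule.map_span, Set.image_pair]
    rw [hmap]
    have cyc : ∀ g : KHat ℓ K ⧸ N, Submodule.span ℤ_[ℓ] {N.mkQ X, N.mkQ Y} =
        Submodule.span ℤ_[ℓ] {g} →
        IsCyclicModule ℓ (Submodule.span ℤ_[ℓ] {N.mkQ X, N.mkQ Y}) := by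
      intro g hg
      rw [hg]
      refine ⟨⟨g, Submodule.mem_span_singleton_self g⟩, fun m => ?_⟩
      obtain ⟨a, ha⟩ := Submodule.mem_span_singleton.1 m.2
      exact ⟨a, Subtype.ext ha⟩
    rcases hdvd with ⟨c, hc⟩ | ⟨c, hc⟩
    · refine cyc (N.mkQ X) ?_
      rw [Set.pair_comm]
      exact Submodule.span_insert_eq_span (hc ▸ Submodule.smul_mem _ c
        (Submodule.mem_span_singleton_self _))
    · exact cyc (N.mkQ Y) (Submodule.span_insert_eq_span (hc ▸ Submodule.smul_mem _ c
        (Submodule.mem_span_singleton_self _)))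

theorem mem_bigHHat_iff {T : Submodule ℤ_[ℓ] (KHat ℓ K)} (x : KHat ℓ K) :
    x ∈ bigHHat T ↔ ∀ φ : KHat ℓ K →ₗ[ℤ_[ℓ]] ℤ_[ℓ], T ≤ φ.ker →
      (∀ ψ : KHat ℓ K →ₗ[ℤ_[ℓ]] ℤ_[ℓ], T ≤ ψ.ker →
        UnitsCPair (unitsChar φ) (unitsChar ψ)) → φ x = 0 := by
  rw [bigHHat, Submodule.mem_sInf]
  constructor
  · intro h φ hφ hC
    refine h φ.ker ⟨isCocyclicOver_ker hφ, fun H' hH' => ?_⟩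
    obtain ⟨ψ, rfl⟩ := hH'.exists_ker_eq
    exact (isRigidHat_inf_ker_iff φ ψ).2 (hC ψ hH'.1)
  · rintro h H ⟨hH, hrig⟩
    obtain ⟨φ, rfl⟩ := hH.exists_ker_eq
    exact h φ hH.1 fun ψ hψ => (isRigidHat_inf_ker_iff φ ψ).1 (hrig _ (isCocyclicOver_ker hψ))

theorem isClosedSubmodule_bigHHat (T : Submodule ℤ_[ℓ] (KHat ℓ K)) :
    IsClosedSubmodule (bigHHat T) := by
  refine fun x hx => (Submodule.mem_sInf).2 fun H hH => hH.1.2.1 x fun n => ?_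
  obtain ⟨t, ht, htx⟩ := hx n
  exact ⟨t, (Submodule.mem_sInf).1 ht H hH, htx⟩

theorem isTorsionFree_quotient_bigHHat (T : Submodule ℤ_[ℓ] (KHat ℓ K)) :
    Module.IsTorsionFree ℤ_[ℓ] (KHat ℓ K ⧸ bigHHat T) where
  isSMulRegular r hr := by
    have hr0 : r ≠ 0 := hr.ne_zero
    intro a b hab
    obtain ⟨x, rfl⟩ := (bigHHat T).mkQ_surjective a
    obtain ⟨y, rfl⟩ := (bigHHat T).mkQ_surjective b
    change r • (bigHHat T).mkQ x = r • (bigHHat T).mkQ y at hab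
    rw [← map_smul, ← map_smul, ← sub_eq_zero, ← map_sub, ← smul_sub, Submodule.mkQ_apply,
      Submodule.Quotient.mk_eq_zero, mem_bigHHat_iff] at hab
    rw [← sub_eq_zero, ← map_sub, Submodule.mkQ_apply, Submodule.Quotient.mk_eq_zero,
      mem_bigHHat_iff]
    intro φ hφ hC
    have := hab φ hφ hC
    rw [map_smul, smul_eq_mul] at this
    exact (mul_eq_zero.1 this).resolve_left hr0

theorem of_neg_one_mem {T : Submodule ℤ_[ℓ] (KHat ℓ K)}
    (htf : Module.IsTorsionFree ℤ_[ℓ] (KHat ℓ K ⧸ T)) : KHat.of ℓ (-1 : Kˣ) ∈ T := by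
  rw [← Submodule.Quotient.mk_eq_zero T]
  -- The class of `-1` is killed by `2`, which is nonzero in `ℤ_ℓ` even for `ℓ = 2`.
  refine smul_right_injective _ (two_ne_zero (α := ℤ_[ℓ])) ?_
  change (2 : ℤ_[ℓ]) • _ = (2 : ℤ_[ℓ]) • _
  rw [smul_zero, ← Submodule.Quotient.mk_smul, two_smul, ← KHat.of_mul]
  simp [KHat.of_one]

theorem exists_isCanonicalValuation_bigHHat {T : Submodule ℤ_[ℓ] (KHat ℓ K)}
    (hcl : IsClosedSubmodule T) (htf : Module.IsTorsionFree ℤ_[ℓ] (KHat ℓ K ⧸ T))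
    (hne : T ≠ bigHHat T) :
    ∃ v : ValuationSubring K, IsCanonicalValuation (unitsInter (bigHHat T)) v ∧
      v.principalUnitGroup ≤ unitsInter T ∧
      IsLeast {S : Submodule ℤ_[ℓ] (KHat ℓ K) | IsClosedSubmodule S ∧
        Module.IsTorsionFree ℤ_[ℓ] (KHat ℓ K ⧸ S) ∧ T ≤ S ∧ v.unitGroup ≤ unitsInter S}
        (bigHHat T) := by
  have hTle : T ≤ bigHHat T := le_sInf fun H hH => hH.1.1
  have hneg : ∀ φ : KHat ℓ K →ₗ[ℤ_[ℓ]] ℤ_[ℓ], T ≤ φ.ker → unitsChar φ (.ofMul (-1)) = 0 :=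
    fun φ hφ => (unitsChar_eq_zero_iff φ _).2 (hφ (of_neg_one_mem htf))
  have sep : ∀ {x}, (∀ φ : KHat ℓ K →ₗ[ℤ_[ℓ]] ℤ_[ℓ], T ≤ φ.ker → φ x = 0) → x ∈ T := by
    refine fun h => by_contra fun hx => ?_
    obtain ⟨φ, hφ, hφx⟩ := exists_functional hcl htf hx
    exact hφx (h φ hφ)
  obtain ⟨φ, hφ, ψ, hψ, hφψ⟩ : ∃ φ : KHat ℓ K →ₗ[ℤ_[ℓ]] ℤ_[ℓ], T ≤ φ.ker ∧
      ∃ ψ : KHat ℓ K →ₗ[ℤ_[ℓ]] ℤ_[ℓ], T ≤ ψ.ker ∧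
        ¬ UnitsCPair (unitsChar φ) (unitsChar ψ) := by
    by_contra! h
    exact hne (le_antisymm hTle fun x hx =>
      sep fun φ hφ => (mem_bigHHat_iff x).1 hx φ hφ (h φ hφ))
  obtain ⟨v, hv, hvT⟩ := isCanonicalValuation_of_not_unitsCPair
    (L := unitsChar '' {φ : KHat ℓ K →ₗ[ℤ_[ℓ]] ℤ_[ℓ] | T ≤ φ.ker}) (T := unitsInter T)
    (H := unitsInter (bigHHat T)) (φ := unitsChar φ) (ψ := unitsChar ψ)
    (by
      rintro _ ⟨φ, hφ, rfl⟩
      exact hneg φ hφ)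
    (fun x => by
      rw [Set.forall_mem_image]
      refine ⟨fun hx φ hφ => (unitsChar_eq_zero_iff φ x).2 (hφ hx), fun h => ?_⟩
      exact sep fun φ hφ => (unitsChar_eq_zero_iff φ x).1 (h hφ))
    (fun x => by
      simp only [Set.forall_mem_image, unitsChar_eq_zero_iff, LinearMap.mem_ker]
      exact mem_bigHHat_iff (KHat.of ℓ x))
    ⟨φ, hφ, rfl⟩ ⟨ψ, hψ, rfl⟩ hφψ
  refine ⟨v, hv, hvT, ⟨isClosedSubmodule_bigHHat T, isTorsionFree_quotient_bigHHat T, hTle, hv.1⟩,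
    fun S ⟨hScl, hStf, hTS, hvS⟩ x hx => by_contra fun hxS => ?_⟩
  -- A functional trivial on `S` kills `T` and `𝒪ᵥˣ`, so it is central and kills `bigHHat T`.
  obtain ⟨χ, hχ, hχx⟩ := exists_functional hScl hStf hxS
  exact hχx ((mem_bigHHat_iff x).1 hx χ (hTS.trans hχ) fun ω hω =>
    unitsCPair_of_unitGroup (hneg ω hω)
      (fun y hy => (unitsChar_eq_zero_iff χ y).2 (hχ (hvS hy)))
      fun y hy => (unitsChar_eq_zero_iff ω y).2 (hω (hvT hy)))

end ProL

end ValRec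

theorem mainTheorem10 (ℓ : ℕ) [Fact ℓ.Prime] (K : Type*) [Field K] :
    (∀ T : Subgroup Kˣ, (∀ x : Kˣ, x ^ ℓ ∈ T) → (-1 : Kˣ) ∈ T → T ≠ ValRec.bigH T →
      ValRec.IsValuative (ValRec.bigH T) ∧
      ∃ v : ValuationSubring K, ValRec.IsCanonicalValuation (ValRec.bigH T) v ∧
        v.principalUnitGroup ≤ T ∧
        T ⊔ v.unitGroup = ValRec.bigH T) ∧
    (∀ T : Submodule ℤ_[ℓ] (ValRec.KHat ℓ K), ValRec.IsClosedSubmodule T →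
      Module.IsTorsionFree ℤ_[ℓ] (ValRec.KHat ℓ K ⧸ T) → T ≠ ValRec.bigHHat T →
      ValRec.IsValuative (ValRec.unitsInter (ValRec.bigHHat T)) ∧
      ∃ v : ValuationSubring K,
        ValRec.IsCanonicalValuation (ValRec.unitsInter (ValRec.bigHHat T)) v ∧
        v.principalUnitGroup ≤ ValRec.unitsInter T ∧
        IsLeast {S : Submodule ℤ_[ℓ] (ValRec.KHat ℓ K) |
            ValRec.IsClosedSubmodule S ∧ Module.IsTorsionFree ℤ_[ℓ] (ValRec.KHat ℓ K ⧸ S) ∧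
              T ≤ S ∧ v.unitGroup ≤ ValRec.unitsInter S}
          (ValRec.bigHHat T)) := by
  refine ⟨fun T hT hneg hne => ?_, fun T hcl htf hne => ?_⟩
  · obtain ⟨v, hv, h⟩ := ValRec.exists_isCanonicalValuation_bigH ℓ hT hneg hne
    exact ⟨⟨v, hv.1⟩, v, hv, h⟩
  · obtain ⟨v, hv, h⟩ := ValRec.exists_isCanonicalValuation_bigHHat hcl htf hne
    exact ⟨⟨v, hv.1⟩, v, hv, h⟩
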